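/- Let $n$ be a natural number and let $B_n$ be the braid group on $n$ strings, i.e. the group generated by $\sigma_1,\dots,\sigma_{n-1}$ subject to the relations $\sigma_j\sigma_k=\sigma_k\sigma_j$ if $|j-k|>1$ and $\sigma_j\sigma_k\sigma_j=\sigma_k\sigma_j\sigma_k$ if $|j-k|=1$. For a simple graph $\Gamma$ (no loops, no multiple edges) with vertex set $X$ and edge set $E(\Gamma)$, let $\mathcal M(\Gamma)$ be its graph monoid (right-angled Artin monoid), given by the monoid presentation $$\mathcal M(\Gamma)=\langle X \mid xy=yx \text{ if } \{x,y\}\in E(\Gamma)\rangle^+ .$$ Let $\Omega$ be the simple graph whose vertex set is $$\Upsilon=\{\alpha\sigma_i^2\alpha^{-1} : \alpha\in B_n,\ 1\le i\le n-1\}\subseteq B_n ,$$ two distinct vertices $u,v$ being joined by an edge if and only if $uv=vu$ in $B_n$. Let $\nu\colon\mathcal M(\Omega)\to\mathbb Z[B_n]$ be the homomorphism from $\mathcal M(\Omega)$ to the multiplicative monoid of the integral group ring of $B_n$ defined by $\nu(u)=u-1$ for all $u\in\Upsilon$. Then $\nu$ is injective. -/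

import Mathlib

/-- The relators of Artin's presentation of the braid group on `n` strings; the index `i : Fin (n - 1)`
stands for the generator usually written `σ_{i+1}`. The first set expresses `σ_j σ_k = σ_k σ_j` for
`|j - k| > 1`, the second `σ_j σ_k σ_j = σ_k σ_j σ_k` for `|j - k| = 1`. -/
def braidRels (n : ℕ) : Set (FreeGroup (Fin (n - 1))) :=
  {r | ∃ j k : Fin (n - 1), 1 < |(j : ℤ) - (k : ℤ)| ∧
      r = (FreeGroup.of j * FreeGroup.of k) * (FreeGroup.of k * FreeGroup.of j)⁻¹} ∪
  {r | ∃ j k : Fin (n - 1), |(j : ℤ) - (k : ℤ)| = 1 ∧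
      r = (FreeGroup.of j * FreeGroup.of k * FreeGroup.of j) *
        (FreeGroup.of k * FreeGroup.of j * FreeGroup.of k)⁻¹}

/-- The braid group `B_n` on `n` strings. -/
abbrev BraidGroup (n : ℕ) : Type := PresentedGroup (braidRels n)

/-- The standard generators of `B_n`. -/
def braidGen (n : ℕ) (i : Fin (n - 1)) : BraidGroup n := PresentedGroup.of i

/-- The relations `x y = y x` for `{x, y}` an edge of the graph `Γ`. -/
inductive graphMonoidRels {X : Type*} (Γ : SimpleGraph X) : FreeMonoid X → FreeMonoid X → Prop
  | comm (x y : X) (h : Γ.Adj x y) :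
      graphMonoidRels Γ (FreeMonoid.of x * FreeMonoid.of y) (FreeMonoid.of y * FreeMonoid.of x)

/-- The graph monoid (right-angled Artin monoid, free partially commutative monoid) of `Γ`. -/
abbrev GraphMonoid {X : Type*} (Γ : SimpleGraph X) : Type _ := PresentedMonoid (graphMonoidRels Γ)

/-- The set of all `B_n`-conjugates of the squares of the standard generators. -/
def conjSquares (n : ℕ) : Set (BraidGroup n) :=
  {u | ∃ (α : BraidGroup n) (i : Fin (n - 1)), u = α * braidGen n i ^ 2 * α⁻¹}

/-- The graph with vertex set `conjSquares n`, in which two distinct vertices are joined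
if and only if they commute in `B_n`. -/
def commGraph (n : ℕ) : SimpleGraph (conjSquares n) where
  Adj u v := u ≠ v ∧ (u : BraidGroup n) * (v : BraidGroup n) = (v : BraidGroup n) * (u : BraidGroup n)
  symm := ⟨fun _ _ h => ⟨h.1.symm, h.2.symm⟩⟩
  loopless := ⟨fun _ h => h.1 rfl⟩

/-- The monoid homomorphism from the graph monoid of `commGraph n` to the multiplicative monoid of
the integral group ring of `B_n` sending each vertex `u` to `u - 1`. -/
noncomputable def nuHom (n : ℕ) : GraphMonoid (commGraph n) →* MonoidAlgebra ℤ (BraidGroup n) :=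
  PresentedMonoid.lift
    (fun u : conjSquares n => MonoidAlgebra.of ℤ (BraidGroup n) (u : BraidGroup n) - 1) (by
      rintro _ _ ⟨x, y, h⟩
      have hc : Commute (MonoidAlgebra.of ℤ (BraidGroup n) (x : BraidGroup n))
          (MonoidAlgebra.of ℤ (BraidGroup n) (y : BraidGroup n)) :=
        Commute.map (show Commute (x : BraidGroup n) (y : BraidGroup n) from h.2) _
      have hd := (hc.sub_left (Commute.one_left _)).sub_right (Commute.one_right _)
      simpa only [map_mul, FreeMonoid.lift_eval_of] using hd.eq)

section GroupRing

variable {G : Type*} [Group G]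

/-- The element `g - 1` of the integral group ring. -/
noncomputable def subOne (g : G) : MonoidAlgebra ℤ G := MonoidAlgebra.of ℤ G g - 1

theorem coeff_subOne_mul (g : G) (P : MonoidAlgebra ℤ G) (h : G) :
    (subOne g * P).coeff h = P.coeff (g⁻¹ * h) - P.coeff h := by
  simp [subOne, sub_mul]

/-- A finitely supported function that is constant along an injective sequence vanishes on it. -/
theorem Finsupp.eq_zero_of_const_on_injective {X : Type*} (f : X →₀ ℤ) (e : ℕ → X)
    (he : Function.Injective e) (hf : ∀ k, f (e k) = f (e 0)) : f (e 0) = 0 := by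
  by_contra h
  refine (Set.infinite_range_of_injective he) (f.support.finite_toSet.subset ?_)
  rintro _ ⟨k, rfl⟩
  simp [hf k, h]

theorem zpow_mul_injective {u : G} (hu : ∀ k : ℤ, u ^ k = 1 → k = 0) (g : G) :
    Function.Injective fun k : ℤ => u ^ k * g := by
  intro a b h
  have h1 : u ^ a = u ^ b := mul_right_cancel h
  have := hu (a - b) (by rw [zpow_sub, h1, mul_inv_cancel])
  omega

theorem coeff_subOne_mul_eq_zero_of_isolated {u : G} (hu : ∀ k : ℤ, u ^ k = 1 → k = 0)
    (P : MonoidAlgebra ℤ G) (h : G)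
    (hP : ∀ k : ℤ, k ≠ 0 → (subOne u * P).coeff (u ^ k * h) = 0) :
    (subOne u * P).coeff h = 0 := by
  have step : ∀ k : ℤ, k ≠ 0 → P.coeff (u ^ (k - 1) * h) = P.coeff (u ^ k * h) := by
    intro k hk
    have := hP k hk
    rw [coeff_subOne_mul, sub_eq_zero] at this
    rw [← this, zpow_sub_one, ← mul_assoc, (Commute.refl u).inv_left.zpow_right k |>.eq]
  have hpos : P.coeff (u ^ (0 : ℤ) * h) = 0 := by
    refine P.coeff.eq_zero_of_const_on_injective (fun k : ℕ => u ^ (k : ℤ) * h)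
      (fun a b hab => by simpa using zpow_mul_injective hu h hab) fun k => ?_
    induction k with
    | zero => rfl
    | succ k ih =>
      rw [← ih]
      have := step ((k : ℤ) + 1) (by omega)
      simp only [add_sub_cancel_right] at this
      push_cast
      exact this.symm
  have hneg : P.coeff (u ^ (-1 - ((0 : ℕ) : ℤ)) * h) = 0 := by
    refine P.coeff.eq_zero_of_const_on_injective (fun k : ℕ => u ^ (-1 - (k : ℤ)) * h)
      (fun a b hab => by
        have := zpow_mul_injective hu h hab
        omega) fun k => ?_
    induction k with
    | zero => rfl
    | succ k ih =>
      rw [← ih]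
      have := step (-1 - (k : ℤ)) (by omega)
      rw [← this]
      congr 3
      push_cast
      ring
  rw [coeff_subOne_mul]
  simp only [zpow_zero, one_mul] at hpos
  simp only [Nat.cast_zero, sub_zero, zpow_neg_one] at hneg
  rw [hpos, hneg, sub_zero]

theorem subOne_mul_left_cancel {u : G} (hu : ∀ k : ℤ, u ^ k = 1 → k = 0)
    {P Q : MonoidAlgebra ℤ G} (h : subOne u * P = subOne u * Q) : P = Q := by
  rw [← sub_eq_zero]
  have h0 : subOne u * (P - Q) = 0 := by rw [mul_sub, h, sub_self]
  ext g
  have step : ∀ g, (P - Q).coeff (u * g) = (P - Q).coeff g := by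
    intro g
    have := congrArg (fun R => R.coeff (u * g)) h0
    simp only [coeff_subOne_mul, inv_mul_cancel_left] at this
    simp only [MonoidAlgebra.coeff_zero, Finsupp.coe_zero, Pi.zero_apply] at this
    omega
  have := (P - Q).coeff.eq_zero_of_const_on_injective (fun k : ℕ => u ^ (k : ℤ) * g)
    (fun a b hab => by simpa using zpow_mul_injective hu g hab) fun k => by
      induction k with
      | zero => rfl
      | succ k ih =>
        rw [← ih, ← step (u ^ (k : ℤ) * g), ← mul_assoc]
        push_cast
        rw [zpow_add_one, (Commute.refl u).zpow_right k |>.eq]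
  simpa using this

/-- If every element of a subgroup is lengthened either by all nontrivial powers of `u` or by all
nontrivial powers of `v`, then the right ideals generated by `u - 1` and `v - 1` meet trivially. -/
theorem subOne_mul_eq_zero_of_growth (K : Subgroup G) {u v : G} (huK : u ∈ K) (hvK : v ∈ K)
    (ℓ : G → ℕ)
    (hℓ : ∀ g ∈ K, (∀ k : ℤ, k ≠ 0 → ℓ g < ℓ (u ^ k * g)) ∨
      (∀ k : ℤ, k ≠ 0 → ℓ g < ℓ (v ^ k * g)))
    {P Q : MonoidAlgebra ℤ G} (hPQ : subOne u * P = subOne v * Q) : subOne u * P = 0 := by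
  classical
  by_contra hR
  obtain ⟨g₀, hg₀⟩ : ∃ g, (subOne u * P).coeff g ≠ 0 := by
    by_contra! h
    exact hR (by ext g; simpa using h g)
  obtain ⟨h, hh, hmax⟩ := ((subOne u * P).coeff.support.filter fun g => g * g₀⁻¹ ∈ K).exists_max_image
    (fun g => ℓ (g * g₀⁻¹)) ⟨g₀, by simp [hg₀, one_mem]⟩
  simp only [Finset.mem_filter, Finsupp.mem_support_iff] at hh hmax
  have key : ∀ (w : G) (T : MonoidAlgebra ℤ G), w ∈ K → subOne u * P = subOne w * T →
      ¬ ∀ k : ℤ, k ≠ 0 → ℓ (h * g₀⁻¹) < ℓ (w ^ k * (h * g₀⁻¹)) := by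
    intro w T hw hT hgrow
    apply hh.1
    rw [hT]
    refine coeff_subOne_mul_eq_zero_of_isolated (fun k hk => ?_) T h fun k hk => ?_
    · by_contra hk0
      simpa [hk] using hgrow k hk0
    · by_contra hne
      rw [← hT] at hne
      have := hmax (w ^ k * h) ⟨hne, by rw [mul_assoc]; exact K.mul_mem (K.zpow_mem hw k) hh.2⟩
      rw [mul_assoc] at this
      exact absurd (hgrow k hk) (not_lt.mpr this)
  rcases hℓ _ hh.2 with h1 | h1
  · exact key u P huK rfl h1
  · exact key v Q hvK hPQ h1

theorem exists_zpow_mul_sub (v : G) (k : ℤ) :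
    ∃ R : MonoidAlgebra ℤ G, MonoidAlgebra.of ℤ G (v ^ k) - 1 = subOne v * R := by
  induction k using Int.induction_on with
  | zero => exact ⟨0, by rw [zpow_zero, map_one, sub_self, mul_zero]⟩
  | succ k ih =>
    obtain ⟨R, hR⟩ := ih
    refine ⟨MonoidAlgebra.of ℤ G (v ^ (k : ℤ)) + R, ?_⟩
    rw [mul_add, ← hR, subOne, sub_mul, ← map_mul, ← zpow_one_add, add_comm (1 : ℤ)]
    simp
  | pred k ih =>
    obtain ⟨R, hR⟩ := ih
    refine ⟨R - MonoidAlgebra.of ℤ G (v ^ (-(k : ℤ) - 1)), ?_⟩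
    rw [mul_sub, ← hR, subOne, sub_mul, ← map_mul, ← zpow_one_add]
    simp

/-- If the coefficients of `P` sum to zero over the cosets `⟨v⟩ g`, then `P` is divisible by
`v - 1` on the left. -/
theorem exists_eq_subOne_mul_of_mapDomain_eq_zero (v : G) (P : MonoidAlgebra ℤ G)
    (hP : Finsupp.mapDomain (Quotient.mk (QuotientGroup.rightRel (Subgroup.zpowers v))) P.coeff
      = 0) : ∃ R, P = subOne v * R := by
  let rep : G → G := fun g =>
    (Quotient.mk (QuotientGroup.rightRel (Subgroup.zpowers v)) g).out
  have hrep : ∀ g, ∃ k : ℤ, g = v ^ k * rep g := by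
    intro g
    have h : QuotientGroup.rightRel (Subgroup.zpowers v) (rep g) g := Quotient.mk_out g
    rw [QuotientGroup.rightRel_apply, Subgroup.mem_zpowers_iff] at h
    obtain ⟨k, hk⟩ := h
    exact ⟨k, by rw [hk]; group⟩
  have main : ∀ P : MonoidAlgebra ℤ G,
      ∃ R, P - MonoidAlgebra.ofCoeff (Finsupp.mapDomain rep P.coeff) = subOne v * R := by
    intro P
    induction P using MonoidAlgebra.induction_linear with
    | zero => exact ⟨0, by ext; simp⟩
    | add P Q hP hQ =>
      obtain ⟨R, hR⟩ := hP
      obtain ⟨S, hS⟩ := hQ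
      refine ⟨R + S, ?_⟩
      rw [mul_add, ← hR, ← hS, MonoidAlgebra.coeff_add, Finsupp.mapDomain_add,
        MonoidAlgebra.ofCoeff_add]
      abel
    | single g c =>
      obtain ⟨k, hk⟩ := hrep g
      obtain ⟨R, hR⟩ := exists_zpow_mul_sub v k
      refine ⟨R * MonoidAlgebra.single (rep g) c, ?_⟩
      rw [← mul_assoc, ← hR, sub_mul, one_mul, MonoidAlgebra.of_apply,
        MonoidAlgebra.single_mul_single, ← hk, one_mul, MonoidAlgebra.coeff_single,
        Finsupp.mapDomain_single]
      rfl
  obtain ⟨R, hR⟩ := main P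
  refine ⟨R, ?_⟩
  have h2 : Finsupp.mapDomain rep P.coeff = 0 := by
    have : rep = Quotient.out ∘ Quotient.mk (QuotientGroup.rightRel (Subgroup.zpowers v)) := rfl
    rw [this, Finsupp.mapDomain_comp, hP, Finsupp.mapDomain_zero]
  rw [← hR, h2]
  simp

theorem mapDomain_rightRel_mul_left (v : G) (Q : MonoidAlgebra ℤ G) :
    Finsupp.mapDomain (Quotient.mk (QuotientGroup.rightRel (Subgroup.zpowers v)))
      (subOne v * Q).coeff = 0 := by
  induction Q using MonoidAlgebra.induction_linear with
  | zero => simp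
  | add P Q hP hQ => rw [mul_add, MonoidAlgebra.coeff_add, Finsupp.mapDomain_add, hP, hQ, add_zero]
  | single g c =>
    rw [subOne, sub_mul, one_mul, MonoidAlgebra.of_apply, MonoidAlgebra.single_mul_single, one_mul,
      sub_eq_add_neg, MonoidAlgebra.coeff_add, MonoidAlgebra.coeff_neg, Finsupp.mapDomain_add,
      MonoidAlgebra.coeff_single, MonoidAlgebra.coeff_single, ← Finsupp.single_neg,
      Finsupp.mapDomain_single, Finsupp.mapDomain_single]
    have : Quotient.mk (QuotientGroup.rightRel (Subgroup.zpowers v)) (v * g) = Quotient.mk _ g := by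
      apply Quotient.sound
      change QuotientGroup.rightRel _ _ _
      rw [QuotientGroup.rightRel_apply]
      refine Subgroup.mem_zpowers_iff.mpr ⟨-1, by simp⟩
    rw [this]
    simp

/-- For commuting independent `u` and `v`, the element `v - 1` divides `P` as soon as it divides
`(u - 1) P`. -/
theorem exists_eq_subOne_mul_of_commute {u v : G} (huv : Commute u v)
    (hind : ∀ a b : ℤ, u ^ a = v ^ b → a = 0)
    {P Q : MonoidAlgebra ℤ G} (hPQ : subOne u * P = subOne v * Q) :
    ∃ R, P = subOne v * R := by
  apply exists_eq_subOne_mul_of_mapDomain_eq_zero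
  set m : G → Quotient (QuotientGroup.rightRel (Subgroup.zpowers v)) := Quotient.mk _ with hm
  have hrel : ∀ x y : G, m x = m y ↔ ∃ k : ℤ, v ^ k = y * x⁻¹ := by
    intro x y
    rw [hm, Quotient.eq, ← Subgroup.mem_zpowers_iff]
    exact QuotientGroup.rightRel_apply
  let U : Quotient (QuotientGroup.rightRel (Subgroup.zpowers v)) →
      Quotient (QuotientGroup.rightRel (Subgroup.zpowers v)) :=
    Quotient.lift (fun g => m (u * g)) fun x y hxy => by
      obtain ⟨k, hk⟩ := (hrel x y).mp (Quotient.sound hxy)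
      refine (hrel _ _).mpr ⟨k, ?_⟩
      rw [mul_inv_rev, mul_assoc, ← mul_assoc y, ← hk, ← mul_assoc, (huv.zpow_right k).eq]
      group
  have hU : ∀ g, U (m g) = m (u * g) := fun _ => rfl
  have hUinj : Function.Injective U := by
    intro a b
    induction a using Quotient.ind with | _ x
    induction b using Quotient.ind with | _ y
    intro h
    obtain ⟨k, hk⟩ := (hrel (u * x) (u * y)).mp h
    refine (hrel x y).mpr ⟨k, ?_⟩
    have h2 : u * v ^ k = u * (y * x⁻¹) := by
      rw [(huv.zpow_right k).eq, hk]; group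
    exact mul_left_cancel h2
  have hmap : ∀ P : MonoidAlgebra ℤ G,
      Finsupp.mapDomain m (MonoidAlgebra.of ℤ G u * P).coeff
        = Finsupp.mapDomain U (Finsupp.mapDomain m P.coeff) := by
    intro P
    induction P using MonoidAlgebra.induction_linear with
    | zero => simp
    | add P Q hP hQ =>
      rw [mul_add, MonoidAlgebra.coeff_add, Finsupp.mapDomain_add, hP, hQ, MonoidAlgebra.coeff_add,
        Finsupp.mapDomain_add, Finsupp.mapDomain_add]
    | single g c =>
      rw [MonoidAlgebra.of_apply, MonoidAlgebra.single_mul_single, one_mul]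
      simp only [MonoidAlgebra.coeff_single, Finsupp.mapDomain_single, hU]
  have hfix : Finsupp.mapDomain U (Finsupp.mapDomain m P.coeff) = Finsupp.mapDomain m P.coeff := by
    have h1 := mapDomain_rightRel_mul_left v Q
    rw [← hPQ] at h1
    have h2 : MonoidAlgebra.of ℤ G u * P = subOne u * P + P := by rw [subOne]; noncomm_ring
    rw [← hmap, h2, MonoidAlgebra.coeff_add, Finsupp.mapDomain_add, h1, zero_add]
  ext a
  induction a using Quotient.ind with | _ x
  have hval : ∀ y, Finsupp.mapDomain m P.coeff (m (u * y)) = Finsupp.mapDomain m P.coeff (m y) := by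
    intro y
    conv_lhs => rw [← hfix, ← hU]
    exact Finsupp.mapDomain_apply hUinj _ _
  have := Finsupp.eq_zero_of_const_on_injective (Finsupp.mapDomain m P.coeff)
    (fun k : ℕ => m (u ^ k * x)) (fun a b hab => by
      obtain ⟨k, hk⟩ := (hrel _ _).mp hab
      have h3 := hind ((b : ℤ) - a) k (by
        rw [hk, zpow_sub, zpow_natCast, zpow_natCast]; group)
      omega) fun k => by
      induction k with
      | zero => rfl
      | succ k ih => rw [← ih, pow_succ', mul_assoc, hval]
  simpa using this

/-- `u - 1` and `v - 1` behave like generators of a graph monoid: either `u = v`, or the right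
ideals they generate meet trivially, or `u` and `v` commute and are independent. -/
def SplitPair (u v : G) : Prop :=
  u = v ∨
  (∀ P Q : MonoidAlgebra ℤ G, subOne u * P = subOne v * Q → subOne u * P = 0) ∨
  (Commute u v ∧ ∀ a b : ℤ, u ^ a = v ^ b → a = 0)

theorem subOne_conj (d u : G) : subOne (d * u * d⁻¹) =
    MonoidAlgebra.of ℤ G d * subOne u * MonoidAlgebra.of ℤ G d⁻¹ := by
  simp only [subOne, mul_sub, sub_mul, ← map_mul]
  rw [mul_one, ← map_mul, mul_inv_cancel, map_one]

theorem SplitPair.conj {u v : G} (h : SplitPair u v) (d : G) :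
    SplitPair (d * u * d⁻¹) (d * v * d⁻¹) := by
  rcases h with rfl | h | ⟨hc, hi⟩
  · exact Or.inl rfl
  · refine Or.inr (Or.inl fun P Q hPQ => ?_)
    rw [subOne_conj, subOne_conj] at hPQ
    have h1 : ∀ X : MonoidAlgebra ℤ G,
        MonoidAlgebra.of ℤ G d⁻¹ * (MonoidAlgebra.of ℤ G d * X) = X := by
      intro X
      rw [← mul_assoc, ← map_mul, inv_mul_cancel, map_one, one_mul]
    have h2 := congrArg (MonoidAlgebra.of ℤ G d⁻¹ * ·) hPQ
    simp only [mul_assoc, h1] at h2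
    have := h _ _ h2
    rw [subOne_conj, mul_assoc, mul_assoc, this, mul_zero]
  · refine Or.inr (Or.inr ⟨?_, fun a b hab => hi a b ?_⟩)
    · change (d * u * d⁻¹) * (d * v * d⁻¹) = (d * v * d⁻¹) * (d * u * d⁻¹)
      have := hc.eq
      calc (d * u * d⁻¹) * (d * v * d⁻¹) = d * (u * v) * d⁻¹ := by group
        _ = _ := by rw [this]; group
    · rw [conj_zpow, conj_zpow] at hab
      exact mul_left_cancel (mul_right_cancel hab)

theorem SplitPair.of_conj {u v : G} (d : G) (h : SplitPair (d * u * d⁻¹) (d * v * d⁻¹)) :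
    SplitPair u v := by
  have := h.conj d⁻¹
  have e : ∀ x : G, d⁻¹ * (d * x * d⁻¹) * d⁻¹⁻¹ = x := fun x => by group
  rwa [e, e] at this

end GroupRing

section BraidGraph

variable {n : ℕ}

theorem nuHom_of (u : conjSquares n) :
    nuHom n (PresentedMonoid.of _ u) = subOne (u : BraidGroup n) := rfl

theorem one_ne_subOne_mul {G : Type*} [Group G] (v : G) (R : MonoidAlgebra ℤ G) :
    (1 : MonoidAlgebra ℤ G) ≠ subOne v * R := by
  intro h
  have := congrArg (MonoidAlgebra.lift ℤ ℤ G 1) h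
  simp [subOne] at this

theorem PresentedMonoid.cons_induction {X : Type*} {rels : FreeMonoid X → FreeMonoid X → Prop}
    {p : PresentedMonoid rels → Prop} (one : p 1) (mul : ∀ x a, p a → p (of rels x * a))
    (a : PresentedMonoid rels) : p a := by
  induction a using PresentedMonoid.inductionOn with | _ w
  induction w using FreeMonoid.inductionOn' with
  | one => exact one
  | of_mul x w ih => rw [map_mul]; exact mul x _ ih

theorem exists_eq_of_mul_of_nuHom_eq
    (hinf : ∀ u ∈ conjSquares n, ∀ k : ℤ, u ^ k = 1 → k = 0)
    (hsplit : ∀ u ∈ conjSquares n, ∀ v ∈ conjSquares n, SplitPair u v)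
    (v : conjSquares n) (a : GraphMonoid (commGraph n)) :
    nuHom n a ≠ 0 ∧ ∀ R, nuHom n a = subOne (v : BraidGroup n) * R →
      ∃ b, a = PresentedMonoid.of _ v * b := by
  induction a using PresentedMonoid.cons_induction with
  | one =>
    refine ⟨by simp, fun R hR => ?_⟩
    rw [map_one] at hR
    exact absurd hR (one_ne_subOne_mul _ _)
  | mul u a ih =>
    have hne : nuHom n (PresentedMonoid.of _ u * a) ≠ 0 := by
      intro h0
      rw [map_mul, nuHom_of, ← mul_zero (subOne (u : BraidGroup n))] at h0
      exact ih.1 (subOne_mul_left_cancel (hinf u u.2) h0)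
    refine ⟨hne, fun R hR => ?_⟩
    rw [map_mul, nuHom_of] at hR hne
    rcases hsplit u u.2 v v.2 with h | h | ⟨hc, hi⟩
    · exact ⟨a, by rw [Subtype.ext h]⟩
    · exact absurd (h _ _ hR) hne
    · by_cases huv : u = v
      · exact ⟨a, by rw [huv]⟩
      obtain ⟨S, hS⟩ := exists_eq_subOne_mul_of_commute hc hi hR
      obtain ⟨b, rfl⟩ := ih.2 S hS
      refine ⟨PresentedMonoid.of _ u * b, ?_⟩
      have hcomm : PresentedMonoid.of (graphMonoidRels (commGraph n)) u * PresentedMonoid.of _ v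
          = PresentedMonoid.of _ v * PresentedMonoid.of _ u :=
        PresentedMonoid.mk_eq_mk_of_rel (.comm u v ⟨huv, hc.eq⟩)
      rw [← mul_assoc, hcomm, mul_assoc]

theorem nuHom_injective_of_splitPair
    (hinf : ∀ u ∈ conjSquares n, ∀ k : ℤ, u ^ k = 1 → k = 0)
    (hsplit : ∀ u ∈ conjSquares n, ∀ v ∈ conjSquares n, SplitPair u v) :
    Function.Injective (nuHom n) := by
  intro a
  induction a using PresentedMonoid.cons_induction with
  | one =>
    intro b hb
    induction b using PresentedMonoid.cons_induction with
    | one => rfl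
    | mul v b _ =>
      rw [map_one, map_mul, nuHom_of] at hb
      exact absurd hb (one_ne_subOne_mul _ _)
  | mul u a ih =>
    intro b hb
    rw [map_mul, nuHom_of] at hb
    obtain ⟨c, rfl⟩ := (exists_eq_of_mul_of_nuHom_eq hinf hsplit u b).2 _ hb.symm
    rw [map_mul, nuHom_of] at hb
    rw [ih (subOne_mul_left_cancel (hinf u u.2) hb)]

end BraidGraph

namespace FreeGroup

variable {α : Type*} [DecidableEq α]

/-- The generator underlying the first letter of the reduced word of `x`. -/
def firstGen (x : FreeGroup α) : Option α := x.toWord.head?.map Prod.fst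

/-- The generator underlying the last letter of the reduced word of `x`. -/
def lastGen (x : FreeGroup α) : Option α := x.toWord.getLast?.map Prod.fst

theorem toWord_mul_of_isReduced {x y : FreeGroup α} (h : IsReduced (x.toWord ++ y.toWord)) :
    (x * y).toWord = x.toWord ++ y.toWord := by
  rw [toWord_mul, h.reduce_eq]

theorem toWord_mul_of_ne {x y : FreeGroup α} (h : ∀ a, x.lastGen = some a → y.firstGen ≠ some a) :
    (x * y).toWord = x.toWord ++ y.toWord := by
  apply toWord_mul_of_isReduced
  refine List.isChain_append.mpr ⟨isReduced_toWord, isReduced_toWord, ?_⟩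
  intro a ha b hb hab
  refine absurd ?_ (h a.1 ?_)
  · rw [firstGen, Option.mem_def.mp hb, hab]; rfl
  · rw [lastGen, Option.mem_def.mp ha]; rfl

theorem norm_mul_of_ne {x y : FreeGroup α} (h : ∀ a, x.lastGen = some a → y.firstGen ≠ some a) :
    (x * y).norm = x.norm + y.norm := by
  rw [norm, toWord_mul_of_ne h, List.length_append, norm, norm]

theorem firstGen_mul_of_ne {x y : FreeGroup α} (hx : x ≠ 1)
    (h : ∀ a, x.lastGen = some a → y.firstGen ≠ some a) :
    (x * y).firstGen = x.firstGen := by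
  rw [firstGen, toWord_mul_of_ne h, List.head?_append_of_ne_nil _ (by simpa using hx), firstGen]

theorem lastGen_inv (x : FreeGroup α) : x⁻¹.lastGen = x.firstGen := by
  rw [lastGen, firstGen, toWord_inv, invRev, List.getLast?_reverse, List.head?_map]
  cases x.toWord.head? <;> rfl

theorem firstGen_inv (x : FreeGroup α) : x⁻¹.firstGen = x.lastGen := by
  rw [← lastGen_inv, inv_inv]

theorem toWord_of_zpow (a : α) (k : ℤ) :
    (of a ^ k).toWord = List.replicate k.natAbs (a, decide (0 ≤ k)) := by
  obtain ⟨m, rfl | rfl⟩ := k.eq_nat_or_neg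
  · simp [toWord_of_pow]
  · rw [zpow_neg, zpow_natCast, toWord_inv, toWord_of_pow]
    rcases Nat.eq_zero_or_pos m with rfl | hm
    · rfl
    · simp [invRev, hm.ne']

theorem norm_of_zpow (a : α) (k : ℤ) : (of a ^ k).norm = k.natAbs := by
  rw [norm, toWord_of_zpow, List.length_replicate]

theorem of_zpow_eq_one {a : α} {k : ℤ} (h : of a ^ k = 1) : k = 0 := by
  have := norm_of_zpow a k
  rw [h, norm_one] at this
  omega

theorem firstGen_of_zpow (a : α) {k : ℤ} (hk : k ≠ 0) : (of a ^ k).firstGen = some a := by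
  rw [firstGen, toWord_of_zpow]
  cases h : k.natAbs with
  | zero => omega
  | succ m => rfl

theorem lastGen_of_zpow (a : α) {k : ℤ} (hk : k ≠ 0) : (of a ^ k).lastGen = some a := by
  rw [← firstGen_inv, ← zpow_neg, firstGen_of_zpow a (by omega)]

theorem mk_singleton_eq_zpow {α : Type*} (a : α) (e : Bool) : ∃ k : ℤ, mk [(a, e)] = of a ^ k := by
  cases e
  · exact ⟨-1, by rw [zpow_neg_one]; rfl⟩
  · exact ⟨1, by rw [zpow_one]; rfl⟩

theorem exists_norm_zpow_mul_lt {x : FreeGroup α} {a : α} (h : x.firstGen = some a) :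
    ∃ k : ℤ, (of a ^ k * x).norm < x.norm := by
  rw [firstGen, Option.map_eq_some_iff] at h
  obtain ⟨⟨a', e⟩, h, rfl⟩ := h
  obtain ⟨t, ht⟩ := List.head?_eq_some_iff.mp h
  obtain ⟨k, hk⟩ := mk_singleton_eq_zpow a' e
  refine ⟨-k, ?_⟩
  have hx : x = of a' ^ k * mk t := by
    rw [← hk, mul_mk, ← mk_toWord (x := x), ht]; rfl
  have : of a' ^ (-k) * x = mk t := by rw [hx, zpow_neg, inv_mul_cancel_left]
  rw [this]
  refine norm_mk_le.trans_lt ?_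
  rw [norm, ht]
  simp

/-- Every double coset `⟨i⟩ f ⟨j⟩` has a representative that neither begins with the letter `i`
nor ends with the letter `j`. -/
theorem exists_trimmed (i j : α) (f : FreeGroup α) :
    ∃ (a b : ℤ) (f₀ : FreeGroup α), f = of i ^ a * f₀ * of j ^ b ∧
      f₀.firstGen ≠ some i ∧ f₀.lastGen ≠ some j := by
  obtain ⟨⟨a, b⟩, -, hmin⟩ := (measure fun p : ℤ × ℤ => (of i ^ p.1 * f * of j ^ p.2).norm).wf.has_min
    Set.univ ⟨(0, 0), trivial⟩
  refine ⟨-a, -b, of i ^ a * f * of j ^ b, by group, fun h => ?_, fun h => ?_⟩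
  · obtain ⟨k, hk⟩ := exists_norm_zpow_mul_lt h
    refine hmin (k + a, b) trivial ?_
    change norm _ < norm _
    rw [zpow_add]
    simpa only [mul_assoc] using hk
  · rw [← firstGen_inv] at h
    obtain ⟨k, hk⟩ := exists_norm_zpow_mul_lt h
    refine hmin (a, b - k) trivial ?_
    change norm _ < norm _
    rw [norm_inv_eq, ← norm_inv_eq] at hk
    convert hk using 2
    group

theorem norm_lt_of_trimmed {i j : α} {f : FreeGroup α} (hi : f.firstGen ≠ some i)
    (hj : f.lastGen ≠ some j) (hne : f ≠ 1 ∨ i ≠ j) (g : FreeGroup α) :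
    (∀ k : ℤ, k ≠ 0 → g.norm < (of i ^ k * g).norm) ∨
    (∀ k : ℤ, k ≠ 0 → g.norm < ((f * of j * f⁻¹) ^ k * g).norm) := by
  by_cases hg : g.firstGen = some i
  · right
    intro k hk
    have h1 : ∀ a, f⁻¹.lastGen = some a → g.firstGen ≠ some a := by
      intro a ha hga
      rw [lastGen_inv] at ha
      rw [hga] at hg
      exact hi (ha.trans hg)
    have h2 : ∀ a, (of j ^ k).lastGen = some a → (f⁻¹ * g).firstGen ≠ some a := by
      intro a ha
      rw [lastGen_of_zpow j hk] at ha
      rw [← ha]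
      by_cases hf : f = 1
      · subst hf
        rw [inv_one, one_mul, hg]
        simpa using hne
      · rw [firstGen_mul_of_ne (by simpa using hf) h1, firstGen_inv]
        exact hj
    have h3 : ∀ a, f.lastGen = some a → (of j ^ k * (f⁻¹ * g)).firstGen ≠ some a := by
      intro a ha
      rw [firstGen_mul_of_ne (fun h => hk (of_zpow_eq_one h)) h2, firstGen_of_zpow j hk, ← ha]
      exact fun h => hj h.symm
    rw [conj_zpow, mul_assoc, mul_assoc, norm_mul_of_ne h3, norm_mul_of_ne h2, norm_mul_of_ne h1,
      norm_of_zpow]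
    omega
  · left
    intro k hk
    rw [norm_mul_of_ne, norm_of_zpow]
    · omega
    · intro a ha
      rw [lastGen_of_zpow i hk] at ha
      rwa [← ha]

/-- The number of occurrences of the generator `z` in the reduced word of `x`. -/
def genCount (z : α) (x : FreeGroup α) : ℕ := x.toWord.countP (·.1 = z)

/-- The part of the reduced word of `x` before the first occurrence of the generator `z`. -/
def prefixBefore (z : α) (x : FreeGroup α) : FreeGroup α :=
  mk (x.toWord.takeWhile (·.1 ≠ z))

variable {z : α}

theorem genCount_inv (x : FreeGroup α) : genCount z x⁻¹ = genCount z x := by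
  rw [genCount, toWord_inv, invRev, List.countP_reverse, List.countP_map, genCount]
  rfl

theorem genCount_mul_le (x y : FreeGroup α) : genCount z (x * y) ≤ genCount z x + genCount z y := by
  rw [genCount, genCount, genCount, ← List.countP_append]
  exact (toWord_mul_sublist x y).countP_le

theorem genCount_mul_left {l : FreeGroup α} (hl : genCount z l = 0) (g : FreeGroup α) :
    genCount z (l * g) = genCount z g := by
  have h1 := genCount_mul_le (z := z) l g
  have h2 := genCount_mul_le (z := z) l⁻¹ (l * g)
  rw [inv_mul_cancel_left, genCount_inv] at h2
  omega

theorem genCount_of_zpow {a : α} (ha : a ≠ z) (k : ℤ) : genCount z (of a ^ k) = 0 := by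
  rw [genCount, toWord_of_zpow, List.countP_eq_zero]
  intro b hb
  rw [List.eq_of_mem_replicate hb]
  simpa using ha

theorem lastGen_ne_of_genCount_eq_zero {x : FreeGroup α} (hx : genCount z x = 0) :
    x.lastGen ≠ some z := by
  rw [genCount, List.countP_eq_zero] at hx
  intro h
  rw [lastGen, Option.map_eq_some_iff] at h
  obtain ⟨a, ha, rfl⟩ := h
  simpa using hx a (List.mem_of_getLast? ha)

theorem firstGen_ne_of_genCount_eq_zero {x : FreeGroup α} (hx : genCount z x = 0) :
    x.firstGen ≠ some z := by
  rw [← lastGen_inv]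
  exact lastGen_ne_of_genCount_eq_zero (by rwa [genCount_inv])

theorem toWord_mul_of_genCount_eq_zero {x y : FreeGroup α} (hx : genCount z x = 0)
    (hy : ∀ a, y.firstGen = some a → a = z) : (x * y).toWord = x.toWord ++ y.toWord := by
  refine toWord_mul_of_ne fun a ha hya => ?_
  rw [hy a hya] at ha
  exact lastGen_ne_of_genCount_eq_zero hx ha

theorem prefixBefore_mul {x y : FreeGroup α} (hx : genCount z x = 0)
    (hy : ∀ a, y.firstGen = some a → a = z) : prefixBefore z (x * y) = x := by
  rw [prefixBefore, toWord_mul_of_genCount_eq_zero hx hy]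
  rw [List.takeWhile_append_of_pos]
  · have : y.toWord.takeWhile (·.1 ≠ z) = [] := by
      rw [firstGen] at hy
      cases h : y.toWord with
      | nil => rfl
      | cons a t =>
        rw [h] at hy
        simp [hy a.1 rfl]
    rw [this, List.append_nil, mk_toWord]
  · rw [genCount, List.countP_eq_zero] at hx
    simpa using hx

theorem exists_eq_prefixBefore_mul (z : α) (g : FreeGroup α) :
    ∃ r, g = prefixBefore z g * r ∧ genCount z (prefixBefore z g) = 0 ∧
      (∀ a, r.firstGen = some a → a = z) ∧ r.norm ≤ g.norm := by
  have hw : g.toWord = g.toWord.takeWhile (·.1 ≠ z) ++ g.toWord.dropWhile (·.1 ≠ z) :=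
    List.takeWhile_append_dropWhile.symm
  have hred : IsReduced g.toWord := isReduced_toWord
  have h1 : (prefixBefore z g).toWord = g.toWord.takeWhile (·.1 ≠ z) := by
    rw [prefixBefore, toWord_mk]
    exact (hred.infix (List.takeWhile_prefix _).isInfix).reduce_eq
  have h2 : (mk (g.toWord.dropWhile (·.1 ≠ z))).toWord = g.toWord.dropWhile (·.1 ≠ z) := by
    rw [toWord_mk]
    exact (hred.infix (List.dropWhile_suffix _).isInfix).reduce_eq
  refine ⟨mk (g.toWord.dropWhile (·.1 ≠ z)), ?_, ?_, ?_, ?_⟩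
  · rw [prefixBefore, mul_mk, ← hw, mk_toWord]
  · rw [genCount, h1, List.countP_eq_zero]
    intro a ha
    simpa using List.mem_takeWhile_imp ha
  · intro a ha
    rw [firstGen, h2, Option.map_eq_some_iff] at ha
    obtain ⟨b, hb, rfl⟩ := ha
    have := List.head?_dropWhile_not (fun a : α × Bool => decide (a.1 ≠ z)) g.toWord
    rw [hb] at this
    simpa using this
  · rw [norm, h2, norm]
    exact (List.dropWhile_suffix _).length_le

theorem prefixBefore_mul_left {l : FreeGroup α} (hl : genCount z l = 0) (g : FreeGroup α) :
    prefixBefore z (l * g) = l * prefixBefore z g := by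
  obtain ⟨r, hr, h0, hz, -⟩ := exists_eq_prefixBefore_mul z g
  conv_lhs => rw [hr, ← mul_assoc]
  exact prefixBefore_mul (by rw [genCount_mul_left hl, h0]) hz

theorem IsReduced.invRev {L : List (α × Bool)} (h : IsReduced L) :
    IsReduced (FreeGroup.invRev L) := by
  rw [isReduced_iff_reduce_eq, reduce_invRev, h.reduce_eq]

theorem IsReduced.exists_common_prefix {L₁ L₂ : List (α × Bool)} (h₁ : IsReduced L₁)
    (h₂ : IsReduced L₂) : ∃ p a b, L₁ = p ++ a ∧ L₂ = p ++ b ∧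
      IsReduced (FreeGroup.invRev a ++ b) := by
  induction L₁ generalizing L₂ with
  | nil => exact ⟨[], [], L₂, rfl, rfl, h₂⟩
  | cons x t ih =>
    cases L₂ with
    | nil => exact ⟨[], x :: t, [], rfl, rfl, by simpa using h₁.invRev⟩
    | cons y s =>
      by_cases hxy : x = y
      · subst hxy
        obtain ⟨p, a, b, rfl, rfl, h⟩ := ih (h₁.infix (List.suffix_cons _ _).isInfix)
          (h₂.infix (List.suffix_cons _ _).isInfix)
        exact ⟨x :: p, a, b, rfl, rfl, h⟩
      · refine ⟨[], x :: t, y :: s, rfl, rfl, ?_⟩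
        refine List.isChain_append.mpr ⟨h₁.invRev, h₂, ?_⟩
        intro a ha b hb hab
        simp only [FreeGroup.invRev, List.map_cons, List.reverse_cons, List.getLast?_append,
          List.getLast?_singleton, Option.some_or, Option.mem_def, Option.some.injEq,
          List.head?_cons] at ha hb
        subst ha hb
        rcases x with ⟨x, e⟩
        rcases y with ⟨y, e'⟩
        simp only at hab
        subst hab
        cases e <;> cases e' <;> simp_all

theorem prefixBefore_eq_of_genCount_ne {x y : FreeGroup α}
    (h : genCount z (x⁻¹ * y) ≠ genCount z x + genCount z y) :
    prefixBefore z x = prefixBefore z y ∧ 0 < genCount z y := by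
  obtain ⟨p, a, b, hx, hy, hred⟩ := (isReduced_toWord (x := x)).exists_common_prefix
    (isReduced_toWord (x := y))
  have hxy : (x⁻¹ * y).toWord = FreeGroup.invRev a ++ b := by
    have : x⁻¹ * y = mk (FreeGroup.invRev a ++ b) := by
      rw [← mk_toWord (x := x), ← mk_toWord (x := y), hx, hy, ← mul_mk, ← mul_mk, ← mul_mk,
        ← inv_mk]
      group
    rw [this, toWord_mk, hred.reduce_eq]
  have hinv : (FreeGroup.invRev a).countP (·.1 = z) = a.countP (·.1 = z) := by
    rw [FreeGroup.invRev, List.countP_reverse, List.countP_map]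
    rfl
  have hp : 0 < p.countP (·.1 = z) := by
    by_contra hp
    apply h
    rw [genCount, hxy, genCount, hx, genCount, hy, List.countP_append, List.countP_append,
      List.countP_append, hinv]
    omega
  have htw : ∀ c, (p ++ c).takeWhile (·.1 ≠ z) = p.takeWhile (·.1 ≠ z) := by
    intro c
    rw [List.takeWhile_append, if_neg]
    intro hlen
    obtain ⟨d, hd, hdz⟩ := List.countP_pos_iff.mp hp
    have hall : p.takeWhile (·.1 ≠ z) = p := (List.takeWhile_prefix _).eq_of_length hlen
    rw [← hall] at hd
    have := List.mem_takeWhile_imp hd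
    simp_all
  refine ⟨by rw [prefixBefore, prefixBefore, hx, hy, htw, htw], ?_⟩
  rw [genCount, hy, List.countP_append]
  omega

/-- The automorphism conjugating the generator `z` by `c ^ k` and fixing all other generators. -/
def twist (z c : α) (k : ℤ) : FreeGroup α →* FreeGroup α :=
  lift fun a => if a = z then of c ^ (-k) * of z * of c ^ k else of a

variable {c : α}

theorem twist_self (z c : α) (k : ℤ) : twist z c k (of z) = of c ^ (-k) * of z * of c ^ k := by
  simp [twist]

theorem twist_of_ne {a : α} (ha : a ≠ z) (k : ℤ) : twist z c k (of a) = of a := by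
  simp [twist, ha]

theorem twist_twist (hc : c ≠ z) (k m : ℤ) (g : FreeGroup α) :
    twist z c k (twist z c m g) = twist z c (k + m) g := by
  have : (twist z c k).comp (twist z c m) = twist z c (k + m) := by
    ext a
    by_cases ha : a = z
    · subst ha
      simp only [MonoidHom.comp_apply, twist_self, _root_.map_mul, map_zpow, twist_of_ne hc]
      group
    · simp [twist_of_ne ha]
  exact DFunLike.congr_fun this g

theorem twist_zero (g : FreeGroup α) : twist z c 0 g = g := by
  have : twist z c 0 = MonoidHom.id _ := by
    ext a
    by_cases ha : a = z
    · subst ha; simp [twist_self]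
    · simp [twist_of_ne ha]
  exact DFunLike.congr_fun this g

theorem twist_eq_self {g : FreeGroup α} (hg : genCount z g = 0) (k : ℤ) : twist z c k g = g := by
  rw [genCount, List.countP_eq_zero] at hg
  rw [← mk_toWord (x := g)]
  generalize g.toWord = L at hg
  induction L with
  | nil => exact _root_.map_one _
  | cons a t ih =>
    have : mk (a :: t) = mk [a] * mk t := by rw [mul_mk]; rfl
    rw [this, _root_.map_mul, ih fun b hb => hg b (List.mem_cons_of_mem _ hb)]
    obtain ⟨m, hm⟩ := mk_singleton_eq_zpow a.1 a.2
    change mk [a] = _ at hm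
    rw [hm, map_zpow, twist_of_ne (by simpa using hg a List.mem_cons_self)]

theorem twist_mk_self (e : Bool) (k : ℤ) :
    twist z c k (mk [(z, e)]) = of c ^ (-k) * mk [(z, e)] * of c ^ k := by
  obtain ⟨m, hm⟩ := mk_singleton_eq_zpow z e
  rw [hm, map_zpow, twist_self]
  have : of c ^ k = (of c ^ (-k))⁻¹ := by rw [zpow_neg, inv_inv]
  rw [this, conj_zpow]

theorem genCount_twist (hc : c ≠ z) (k : ℤ) (g : FreeGroup α) :
    genCount z (twist z c k g) = genCount z g := by
  have hle : ∀ (k : ℤ) (L : List (α × Bool)),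
      genCount z (twist z c k (mk L)) ≤ L.countP (·.1 = z) := by
    intro k L
    induction L with
    | nil => exact (congrArg (genCount z) (_root_.map_one (twist z c k))).le
    | cons a t ih =>
      have h1 : mk (a :: t) = mk [a] * mk t := by rw [mul_mk]; rfl
      rw [h1, _root_.map_mul, List.countP_cons]
      refine (genCount_mul_le _ _).trans ?_
      rcases a with ⟨a, e⟩
      by_cases ha : a = z
      · subst ha
        rw [twist_mk_self]
        have h2 : genCount a (of c ^ (-k) * mk [(a, e)] * of c ^ k) ≤ 1 := by
          refine (genCount_mul_le _ _).trans ?_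
          rw [genCount_mul_left (genCount_of_zpow hc _), genCount_of_zpow hc]
          simp [genCount]
        simp only [decide_true, if_true]
        omega
      · obtain ⟨m, hm⟩ := mk_singleton_eq_zpow a e
        rw [hm, map_zpow, twist_of_ne ha, genCount_of_zpow ha]
        omega
  have hle' : ∀ (k : ℤ) (g : FreeGroup α), genCount z (twist z c k g) ≤ genCount z g := by
    intro k g
    conv_lhs => rw [← mk_toWord (x := g)]
    exact hle k _
  refine le_antisymm (hle' k g) ?_
  have := hle' (-k) (twist z c k g)
  rwa [twist_twist hc, neg_add_cancel, twist_zero] at this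

theorem head_twist (hc : c ≠ z) (k : ℤ) (g : FreeGroup α) (hg : g.firstGen = some z) :
    (of c ^ k * twist z c k g).toWord.head? = g.toWord.head? := by
  induction hn : g.norm using Nat.strong_induction_on generalizing g with
  | _ n ih =>
  rw [firstGen, Option.map_eq_some_iff] at hg
  obtain ⟨⟨z', e⟩, hg, hz'⟩ := hg
  simp only at hz'
  subst hz'
  obtain ⟨t, ht⟩ := List.head?_eq_some_iff.mp hg
  have hred : IsReduced ((z', e) :: t) := by rw [← ht]; exact isReduced_toWord
  set g₁ := mk t with hg₁
  have hg₁w : g₁.toWord = t := by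
    rw [hg₁, toWord_mk, (hred.infix (List.suffix_cons _ _).isInfix).reduce_eq]
  have hgg : g = mk [(z', e)] * g₁ := by
    rw [hg₁, mul_mk, ← mk_toWord (x := g), ht]; rfl
  have hnorm : g₁.norm < n := by
    rw [norm, hg₁w, ← hn, norm, ht]; simp
  have hh : (of c ^ k * twist z' c k g₁).toWord.head? ≠ some (z', !e) := by
    obtain ⟨r, hr, h0, hz, hrn⟩ := exists_eq_prefixBefore_mul z' g₁
    by_cases hr1 : r = 1
    · rw [hr1, mul_one] at hr
      rw [← hr] at h0
      rw [twist_eq_self h0]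
      intro hcon
      refine firstGen_ne_of_genCount_eq_zero
        ((genCount_mul_left (genCount_of_zpow hc k) g₁).trans h0) ?_
      rw [firstGen, hcon]
      rfl
    · have hrz : r.firstGen = some z' := by
        rw [firstGen] at hz ⊢
        cases hrw : r.toWord with
        | nil => exact absurd (toWord_eq_nil_iff.mp hrw) hr1
        | cons a s =>
          rw [hrw] at hz
          simp [hz a.1 rfl]
      have hIH := ih r.norm (by omega) r hrz rfl
      have heq : of c ^ k * twist z' c k g₁ =
          (of c ^ k * prefixBefore z' g₁ * of c ^ (-k)) * (of c ^ k * twist z' c k r) := by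
        conv_lhs => rw [hr]
        rw [_root_.map_mul, twist_eq_self h0]
        group
      have hl0 : genCount z' (of c ^ k * prefixBefore z' g₁ * of c ^ (-k)) = 0 := by
        have := genCount_mul_le (z := z') (of c ^ k * prefixBefore z' g₁) (of c ^ (-k))
        rw [genCount_mul_left (genCount_of_zpow hc k), h0, genCount_of_zpow hc] at this
        omega
      have hfirst : ∀ a, (of c ^ k * twist z' c k r).firstGen = some a → a = z' := by
        intro a ha
        rw [firstGen, hIH] at ha
        exact hz a ha
      by_cases hl : prefixBefore z' g₁ = 1
      · rw [hl, one_mul] at hr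
        rw [heq, hl]
        simp only [mul_one, ← zpow_add, add_neg_cancel, zpow_zero, one_mul]
        rw [hIH, ← hr, hg₁w]
        intro hcon
        obtain ⟨s, rfl⟩ := List.head?_eq_some_iff.mp hcon
        have := (isReduced_cons_cons.mp hred).1 rfl
        cases e <;> simp at this
      · rw [heq]
        intro hcon
        rw [toWord_mul_of_genCount_eq_zero hl0 hfirst, List.head?_append_of_ne_nil] at hcon
        · apply firstGen_ne_of_genCount_eq_zero hl0
          rw [firstGen, hcon]
          rfl
        · rw [Ne, toWord_eq_nil_iff]
          intro hcon2
          apply hl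
          have : prefixBefore z' g₁ = of c ^ (-k) *
              (of c ^ k * prefixBefore z' g₁ * of c ^ (-k)) * of c ^ k := by group
          rw [this, hcon2]
          group
  have heq : of c ^ k * twist z' c k g = mk [(z', e)] * (of c ^ k * twist z' c k g₁) := by
    conv_lhs => rw [hgg]
    rw [_root_.map_mul, twist_mk_self]
    group
  have hword : (mk [(z', e)] * (of c ^ k * twist z' c k g₁)).toWord =
      (mk [(z', e)]).toWord ++ (of c ^ k * twist z' c k g₁).toWord := by
    apply toWord_mul_of_isReduced
    refine List.isChain_append.mpr ⟨isReduced_toWord, isReduced_toWord, ?_⟩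
    intro a ha b hb hab
    simp only [toWord_mk, reduce_singleton, List.getLast?_singleton, Option.mem_def,
      Option.some.injEq] at ha
    subst ha
    rcases b with ⟨b, e'⟩
    simp only at hab
    subst hab
    rw [Option.mem_def.mp hb] at hh
    cases e <;> cases e' <;> simp_all
  rw [heq, hword, hg, toWord_mk, reduce_singleton]
  rfl

theorem prefixBefore_twist (hc : c ≠ z) (k : ℤ) {g : FreeGroup α} (hg : 0 < genCount z g) :
    prefixBefore z (twist z c k g) = prefixBefore z g * of c ^ (-k) := by
  obtain ⟨r, hr, h0, hz, -⟩ := exists_eq_prefixBefore_mul z g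
  have hrz : r.firstGen = some z := by
    rw [firstGen] at hz ⊢
    cases hrw : r.toWord with
    | nil =>
      rw [toWord_eq_nil_iff.mp hrw, mul_one] at hr
      rw [hr, h0] at hg
      exact absurd hg (lt_irrefl _)
    | cons a s =>
      rw [hrw] at hz
      simp [hz a.1 rfl]
  have heq : twist z c k g = (prefixBefore z g * of c ^ (-k)) * (of c ^ k * twist z c k r) := by
    conv_lhs => rw [hr]
    rw [_root_.map_mul, twist_eq_self h0]
    group
  rw [heq]
  refine prefixBefore_mul ?_ ?_
  · rw [genCount_mul_left h0, genCount_of_zpow hc]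
  · intro a ha
    rw [firstGen, head_twist hc k r hrz] at ha
    exact hz a ha

theorem genCount_lt_of_pos (hc : c ≠ z) {j : α} (hj : j ≠ z) {f : FreeGroup α}
    (hf : 0 < genCount z f) (g : FreeGroup α) :
    (∀ k : ℤ, k ≠ 0 → genCount z g + genCount z (f⁻¹ * g) <
      genCount z (twist z c k g) + genCount z (f⁻¹ * twist z c k g)) ∨
    (∀ k : ℤ, k ≠ 0 → genCount z g + genCount z (f⁻¹ * g) <
      genCount z ((f * of j * f⁻¹) ^ k * g) + genCount z (f⁻¹ * ((f * of j * f⁻¹) ^ k * g))) := by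
  by_cases hS : genCount z (f⁻¹ * g) = genCount z f + genCount z g
  · right
    intro k hk
    set h := f⁻¹ * g with hh
    have hg : f * h = g := by rw [hh, mul_inv_cancel_left]
    have e1 : (f * of j * f⁻¹) ^ k * g = f * (of j ^ k * h) := by
      rw [conj_zpow, hh]; group
    rw [e1, inv_mul_cancel_left, genCount_mul_left (genCount_of_zpow hj k)]
    have h1 : prefixBefore z f⁻¹ = prefixBefore z h := by
      refine (prefixBefore_eq_of_genCount_ne ?_).1
      rw [inv_inv, hg, genCount_inv]
      omega
    have h2 : genCount z (f * (of j ^ k * h)) = genCount z f + genCount z h := by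
      by_contra hcon
      have h3 := (prefixBefore_eq_of_genCount_ne (z := z) (x := f⁻¹) (y := of j ^ k * h) (by
        rwa [inv_inv, genCount_inv, genCount_mul_left (genCount_of_zpow hj k)])).1
      rw [prefixBefore_mul_left (genCount_of_zpow hj k), h1] at h3
      exact hk (of_zpow_eq_one (right_eq_mul.mp h3))
    omega
  · left
    intro k hk
    have hle := genCount_mul_le (z := z) f⁻¹ g
    rw [genCount_inv] at hle
    obtain ⟨h1, hg⟩ := prefixBefore_eq_of_genCount_ne hS
    have h2 : genCount z (f⁻¹ * twist z c k g) = genCount z f + genCount z (twist z c k g) := by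
      by_contra hcon
      have h3 := (prefixBefore_eq_of_genCount_ne hcon).1
      rw [prefixBefore_twist hc k hg, h1] at h3
      have := of_zpow_eq_one (left_eq_mul.mp h3)
      omega
    rw [h2, genCount_twist hc]
    omega

end FreeGroup

section BraidGenerators

variable {n : ℕ}

/-- The generators of the braid group indexed by all natural numbers, trivial out of range. -/
def braidS (n k : ℕ) : BraidGroup n := if h : k < n - 1 then braidGen n ⟨k, h⟩ else 1

theorem braidS_of_lt {k : ℕ} (h : k < n - 1) : braidS n k = braidGen n ⟨k, h⟩ := dif_pos h

theorem braidS_of_le {k : ℕ} (h : n - 1 ≤ k) : braidS n k = 1 := dif_neg (by omega)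

theorem braidS_commute {j k : ℕ} (h : j + 1 < k) : Commute (braidS n j) (braidS n k) := by
  by_cases hk : k < n - 1
  · have hj : j < n - 1 := by omega
    rw [braidS_of_lt hk, braidS_of_lt hj]
    refine PresentedGroup.mk_eq_mk_of_mul_inv_mem (Or.inl ⟨⟨j, hj⟩, ⟨k, hk⟩, ?_, rfl⟩)
    rw [lt_abs]
    right
    simp only [neg_sub]
    omega
  · rw [braidS_of_le (not_lt.mp hk)]
    exact Commute.one_right _

theorem braidS_braid {k : ℕ} (h : k + 1 < n - 1) :
    braidS n k * braidS n (k + 1) * braidS n k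
      = braidS n (k + 1) * braidS n k * braidS n (k + 1) := by
  have hk : k < n - 1 := by omega
  rw [braidS_of_lt hk, braidS_of_lt h]
  refine PresentedGroup.mk_eq_mk_of_mul_inv_mem (Or.inr ⟨⟨k, hk⟩, ⟨k + 1, h⟩, ?_, rfl⟩)
  simp

/-- A sequence satisfying the braid relations defines a homomorphism from the braid group. -/
def braidLift {H : Type*} [Group H] (n : ℕ) (f : ℕ → H)
    (hcomm : ∀ j k, j + 1 < k → f j * f k = f k * f j)
    (hbraid : ∀ k, f k * f (k + 1) * f k = f (k + 1) * f k * f (k + 1)) : BraidGroup n →* H :=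
  PresentedGroup.toGroup (f := fun i : Fin (n - 1) => f i) (by
    rintro r (⟨j, k, hjk, rfl⟩ | ⟨j, k, hjk, rfl⟩)
    · simp only [map_mul, map_inv, FreeGroup.lift_apply_of, mul_inv_eq_one]
      rcases lt_abs.mp hjk with h | h
      · exact (hcomm k j (by omega)).symm
      · exact hcomm j k (by omega)
    · simp only [map_mul, map_inv, FreeGroup.lift_apply_of, mul_inv_eq_one]
      rcases (abs_eq (by norm_num)).mp hjk with h | h
      · have : (j : ℕ) = k + 1 := by omega
        rw [this]
        exact (hbraid k).symm
      · have : (k : ℕ) = j + 1 := by omega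
        rw [this]
        exact hbraid j)

theorem braidLift_braidS {H : Type*} [Group H] (f : ℕ → H)
    (hcomm : ∀ j k, j + 1 < k → f j * f k = f k * f j)
    (hbraid : ∀ k, f k * f (k + 1) * f k = f (k + 1) * f k * f (k + 1)) {k : ℕ} (hk : k < n - 1) :
    braidLift n f hcomm hbraid (braidS n k) = f k := by
  rw [braidS_of_lt hk]
  exact PresentedGroup.toGroup.of _

theorem braid_induction {p : BraidGroup n → Prop} (one : p 1)
    (mul : ∀ k < n - 1, ∀ g, p g → p (braidS n k * g))
    (inv_mul : ∀ k < n - 1, ∀ g, p g → p ((braidS n k)⁻¹ * g)) (g : BraidGroup n) : p g := by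
  have hg : g ∈ Subgroup.closure (Set.range (PresentedGroup.of (rels := braidRels n))) := by
    rw [PresentedGroup.closure_range_of]; trivial
  induction hg using Subgroup.closure_induction_left with
  | one => exact one
  | mul_left x hx y hy ih =>
    obtain ⟨i, rfl⟩ := hx
    have := mul i i.2 y ih
    rwa [braidS_of_lt i.2] at this
  | inv_mul_cancel x hx y hy ih =>
    obtain ⟨i, rfl⟩ := hx
    have := inv_mul i i.2 y ih
    rwa [braidS_of_lt i.2] at this

/-- The exponent sum. -/
def braidDegree (n : ℕ) : BraidGroup n →* Multiplicative ℤ :=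
  braidLift n (fun _ => Multiplicative.ofAdd 1) (fun _ _ _ => rfl) (fun _ => rfl)

theorem braidDegree_braidS {k : ℕ} (hk : k < n - 1) :
    braidDegree n (braidS n k) = Multiplicative.ofAdd 1 := braidLift_braidS _ _ _ hk

theorem swap_braid (k : ℕ) :
    Equiv.swap k (k + 1) * Equiv.swap (k + 1) (k + 1 + 1) * Equiv.swap k (k + 1) =
      Equiv.swap (k + 1) (k + 1 + 1) * Equiv.swap k (k + 1) * Equiv.swap (k + 1) (k + 1 + 1) := by
  ext i
  simp only [Equiv.Perm.mul_apply, Equiv.swap_apply_def]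
  split_ifs <;> omega

/-- The permutation of the strands induced by a braid. -/
def braidPerm (n : ℕ) : BraidGroup n →* Equiv.Perm ℕ :=
  braidLift n (fun k => Equiv.swap k (k + 1))
    (fun j k h => by
      ext i
      simp only [Equiv.Perm.mul_apply, Equiv.swap_apply_def]
      split_ifs <;> omega)
    swap_braid

theorem braidPerm_braidS {k : ℕ} (hk : k < n - 1) :
    braidPerm n (braidS n k) = Equiv.swap k (k + 1) := braidLift_braidS _ _ _ hk

theorem braidPerm_le (g : BraidGroup n) {i : ℕ} (hi : i ≤ n - 1) : braidPerm n g i ≤ n - 1 := by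
  induction g using braid_induction with
  | one => simpa using hi
  | mul k hk g ih =>
    rw [map_mul, Equiv.Perm.mul_apply, braidPerm_braidS hk, Equiv.swap_apply_def]
    split_ifs <;> omega
  | inv_mul k hk g ih =>
    rw [map_mul, Equiv.Perm.mul_apply, map_inv, braidPerm_braidS hk, Equiv.swap_inv,
      Equiv.swap_apply_def]
    split_ifs <;> omega

end BraidGenerators

section ArtinAction

open FreeGroup (of)

theorem FreeGroup.hom_apply_congr {H : Type*} [Group H] {f g : FreeGroup ℕ →* H}
    (h : ∀ i, f (of i) = g (of i)) (x : FreeGroup ℕ) : f x = g x :=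
  DFunLike.congr_fun (FreeGroup.ext_hom f g h) x

/-- The automorphism of the free group by which the `k`-th generator of the braid group acts. -/
def artin (k : ℕ) : FreeGroup ℕ ≃* FreeGroup ℕ :=
  MonoidHom.toMulEquiv
    (FreeGroup.lift fun i =>
      if i = k then (of k)⁻¹ * of (k + 1) * of k else if i = k + 1 then of k else of i)
    (FreeGroup.lift fun i =>
      if i = k then of (k + 1) else if i = k + 1 then of (k + 1) * of k * (of (k + 1))⁻¹ else of i)
    (by
      ext i
      by_cases h1 : i = k
      · subst h1; simp [mul_assoc]
      · by_cases h2 : i = k + 1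
        · subst h2; simp
        · simp [h1, h2])
    (by
      ext i
      by_cases h1 : i = k
      · subst h1; simp
      · by_cases h2 : i = k + 1
        · subst h2; simp [mul_assoc]
        · simp [h1, h2])

theorem artin_self (k : ℕ) : artin k (of k) = (of k)⁻¹ * of (k + 1) * of k := by
  simp [artin]

theorem artin_succ (k : ℕ) : artin k (of (k + 1)) = of k := by
  simp [artin]

theorem artin_of_ne {k i : ℕ} (h1 : i ≠ k) (h2 : i ≠ k + 1) : artin k (of i) = of i := by
  simp [artin, h1, h2]

theorem artin_comm {j k : ℕ} (h : j + 1 < k) (x : FreeGroup ℕ) :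
    artin j (artin k x) = artin k (artin j x) := by
  refine FreeGroup.hom_apply_congr (f := (artin j).toMonoidHom.comp (artin k).toMonoidHom)
    (g := (artin k).toMonoidHom.comp (artin j).toMonoidHom) (fun i => ?_) x
  simp only [MonoidHom.comp_apply, MulEquiv.coe_toMonoidHom]
  rcases eq_or_ne i j with rfl | h1
  · rw [artin_of_ne (k := k) (by omega) (by omega), artin_self]
    simp only [map_mul, map_inv]
    rw [artin_of_ne (by omega) (by omega), artin_of_ne (by omega) (by omega)]
  rcases eq_or_ne i (j + 1) with rfl | h2
  · rw [artin_of_ne (k := k) (by omega) (by omega), artin_succ,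
      artin_of_ne (by omega) (by omega)]
  rw [artin_of_ne h1 h2]
  rcases eq_or_ne i k with rfl | h3
  · rw [artin_self]
    simp only [map_mul, map_inv]
    rw [artin_of_ne (by omega) (by omega), artin_of_ne (by omega) (by omega)]
  rcases eq_or_ne i (k + 1) with rfl | h4
  · rw [artin_succ, artin_of_ne (by omega) (by omega)]
  rw [artin_of_ne h3 h4, artin_of_ne h1 h2]

theorem artin_braid (k : ℕ) (x : FreeGroup ℕ) :
    artin k (artin (k + 1) (artin k x)) = artin (k + 1) (artin k (artin (k + 1) x)) := by
  refine FreeGroup.hom_apply_congr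
    (f := (artin k).toMonoidHom.comp ((artin (k + 1)).toMonoidHom.comp (artin k).toMonoidHom))
    (g := (artin (k + 1)).toMonoidHom.comp ((artin k).toMonoidHom.comp
      (artin (k + 1)).toMonoidHom)) (fun i => ?_) x
  simp only [MonoidHom.comp_apply, MulEquiv.coe_toMonoidHom]
  have e1 : artin (k + 1) (of k) = of k := artin_of_ne (by omega) (by omega)
  have e2 : artin k (of (k + 1 + 1)) = of (k + 1 + 1) := artin_of_ne (by omega) (by omega)
  rcases eq_or_ne i k with rfl | h1
  · simp only [artin_self, artin_succ, map_mul, map_inv, e1, e2]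
    group
  rcases eq_or_ne i (k + 1) with rfl | h2
  · simp only [artin_self, artin_succ, map_mul, map_inv, e1, e2]
  rcases eq_or_ne i (k + 1 + 1) with rfl | h3
  · simp only [artin_succ, e1, e2]
  rw [artin_of_ne h1 h2, artin_of_ne h2 h3, artin_of_ne h1 h2, artin_of_ne h2 h3]

/-- The action of the `k`-th braid generator on `ℕ × FreeGroup ℕ`, induced from the action of
the stabilizer of a strand on the free group. -/
def strandPerm (k : ℕ) : Equiv.Perm (ℕ × FreeGroup ℕ) where
  toFun p := if p.1 < k then (p.1, artin (k - 1) p.2) else if p.1 = k then (k + 1, of k * p.2)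
    else if p.1 = k + 1 then (k, p.2) else (p.1, artin k p.2)
  invFun p := if p.1 < k then (p.1, (artin (k - 1)).symm p.2) else if p.1 = k then (k + 1, p.2)
    else if p.1 = k + 1 then (k, (of k)⁻¹ * p.2) else (p.1, (artin k).symm p.2)
  left_inv p := by
    rcases p with ⟨i, f⟩
    rcases lt_trichotomy i k with h | rfl | h
    · simp [h]
    · simp
    · rcases eq_or_ne i (k + 1) with rfl | h2
      · simp
      · simp [h.not_gt, h.ne', h2]
  right_inv p := by
    rcases p with ⟨i, f⟩
    rcases lt_trichotomy i k with h | rfl | h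
    · simp [h]
    · simp
    · rcases eq_or_ne i (k + 1) with rfl | h2
      · simp
      · simp [h.not_gt, h.ne', h2]

theorem strandPerm_lt {i k : ℕ} (h : i < k + 1) (f : FreeGroup ℕ) :
    strandPerm (k + 1) (i, f) = (i, artin k f) := by
  rw [strandPerm, Equiv.coe_fn_mk, if_pos h, Nat.add_sub_cancel]

theorem strandPerm_self (k : ℕ) (f : FreeGroup ℕ) :
    strandPerm k (k, f) = (k + 1, of k * f) := by
  simp [strandPerm]

theorem strandPerm_succ (k : ℕ) (f : FreeGroup ℕ) : strandPerm k (k + 1, f) = (k, f) := by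
  simp [strandPerm]

theorem strandPerm_gt {i k : ℕ} (h : k + 1 < i) (f : FreeGroup ℕ) :
    strandPerm k (i, f) = (i, artin k f) := by
  have h1 : ¬ i < k := by omega
  have h2 : i ≠ k := by omega
  have h3 : i ≠ k + 1 := by omega
  simp [strandPerm, h1, h2, h3]

theorem strandPerm_comm (j k : ℕ) (h : j + 1 < k) :
    strandPerm j * strandPerm k = strandPerm k * strandPerm j := by
  obtain ⟨k, rfl⟩ : ∃ m, k = m + 1 := ⟨k - 1, by omega⟩
  refine Equiv.ext fun ⟨i, f⟩ => ?_
  simp only [Equiv.Perm.mul_apply]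
  rcases lt_trichotomy i j with hi | rfl | hi
  · obtain ⟨j, rfl⟩ : ∃ m, j = m + 1 := ⟨j - 1, by omega⟩
    have h1 : i < k + 1 := by omega
    have h2 : j + 1 < k := by omega
    simp only [strandPerm_lt h1, strandPerm_lt hi, artin_comm h2]
  · have h1 : i < k + 1 := by omega
    simp only [strandPerm_lt h1, strandPerm_lt h, strandPerm_self, map_mul]
    rw [artin_of_ne (by omega) (by omega)]
  rcases eq_or_ne i (j + 1) with rfl | hi2
  · have h1 : j < k + 1 := by omega
    simp only [strandPerm_lt h, strandPerm_lt h1, strandPerm_succ]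
  have hji : j + 1 < i := by omega
  rcases lt_trichotomy i (k + 1) with hk | rfl | hk
  · have h1 : j + 1 < k := by omega
    simp only [strandPerm_lt hk, strandPerm_gt hji, artin_comm h1]
  · have h1 : j + 1 < k + 1 + 1 := by omega
    simp only [strandPerm_gt hji, strandPerm_gt h1, strandPerm_self, map_mul]
    rw [artin_of_ne (by omega) (by omega)]
  rcases eq_or_ne i (k + 1 + 1) with rfl | hk2
  · simp only [strandPerm_gt hji, strandPerm_gt h, strandPerm_succ]
  have hki : k + 1 + 1 < i := by omega
  simp only [strandPerm_gt hji, strandPerm_gt hki, artin_comm h]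

theorem strandPerm_braid (k : ℕ) :
    strandPerm k * strandPerm (k + 1) * strandPerm k
      = strandPerm (k + 1) * strandPerm k * strandPerm (k + 1) := by
  refine Equiv.ext fun ⟨i, f⟩ => ?_
  simp only [Equiv.Perm.mul_apply]
  have h0 : k < k + 1 := by omega
  have h1 : k + 1 < k + 1 + 1 := by omega
  rcases lt_trichotomy i k with hi | rfl | hi
  · obtain ⟨k, rfl⟩ : ∃ m, k = m + 1 := ⟨k - 1, by omega⟩
    simp only [strandPerm_lt hi, strandPerm_lt (show i < k + 1 + 1 by omega), artin_braid]
  · simp only [strandPerm_self, strandPerm_lt h0, strandPerm_gt h1, map_mul, artin_self,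
      artin_succ]
    simp [mul_assoc]
  rcases eq_or_ne i (k + 1) with rfl | hi2
  · simp only [strandPerm_succ, strandPerm_self, strandPerm_lt h0, strandPerm_gt h1, map_mul,
      artin_succ]
  rcases eq_or_ne i (k + 1 + 1) with rfl | hi3
  · simp only [strandPerm_succ, strandPerm_lt h0, strandPerm_gt h1]
  have h2 : k + 1 < i := by omega
  have h3 : k + 1 + 1 < i := by omega
  simp only [strandPerm_gt h2, strandPerm_gt h3, artin_braid]

/-- The action of the braid group on `ℕ × FreeGroup ℕ`. -/
def strandAction (n : ℕ) : BraidGroup n →* Equiv.Perm (ℕ × FreeGroup ℕ) :=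
  braidLift n strandPerm strandPerm_comm strandPerm_braid

theorem strandAction_braidS {n k : ℕ} (hk : k < n - 1) :
    strandAction n (braidS n k) = strandPerm k := braidLift_braidS _ _ _ hk

theorem strandPerm_fst (k : ℕ) (p : ℕ × FreeGroup ℕ) :
    (strandPerm k p).1 = Equiv.swap k (k + 1) p.1 := by
  rcases p with ⟨i, f⟩
  simp only [strandPerm, Equiv.coe_fn_mk, Equiv.swap_apply_def]
  split_ifs <;> omega

theorem strandAction_fst {n : ℕ} (g : BraidGroup n) (p : ℕ × FreeGroup ℕ) :
    (strandAction n g p).1 = braidPerm n g p.1 := by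
  induction g using braid_induction generalizing p with
  | one => simp
  | mul k hk g ih =>
    rw [map_mul, map_mul, Equiv.Perm.mul_apply, Equiv.Perm.mul_apply, strandAction_braidS hk,
      strandPerm_fst, ih, braidPerm_braidS hk]
  | inv_mul k hk g ih =>
    rw [map_mul, map_mul, Equiv.Perm.mul_apply, Equiv.Perm.mul_apply, map_inv, map_inv,
      strandAction_braidS hk, braidPerm_braidS hk, Equiv.Perm.eq_inv_iff_eq, ← strandPerm_fst,
      ← Equiv.Perm.mul_apply, mul_inv_cancel, Equiv.Perm.one_apply, ih]

end ArtinAction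

section StrandSubgroup

open FreeGroup (of)

variable {n : ℕ}

/-- The braid `σ_i σ_{i+1} ⋯ σ_{n-2}`, carrying the last strand to the strand `i`. -/
def strandRep (n i : ℕ) : BraidGroup n :=
  ((List.range' i (n - 1 - i)).map (braidS n)).prod

theorem strandRep_of_le {i : ℕ} (h : n - 1 ≤ i) : strandRep n i = 1 := by
  rw [strandRep, Nat.sub_eq_zero_of_le h]
  rfl

theorem strandRep_eq (i : ℕ) : strandRep n i = braidS n i * strandRep n (i + 1) := by
  by_cases h : i < n - 1
  · have : n - 1 - i = (n - 1 - (i + 1)) + 1 := by omega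
    rw [strandRep, this, List.range'_succ, List.map_cons, List.prod_cons, strandRep]
  · rw [strandRep_of_le (by omega), strandRep_of_le (by omega), braidS_of_le (by omega), one_mul]

theorem braidS_commute_strandRep {k i : ℕ} (h : k + 1 < i) :
    Commute (braidS n k) (strandRep n i) := by
  refine Commute.list_prod_right _ _ fun x hx => ?_
  obtain ⟨j, hj, rfl⟩ := List.mem_map.mp hx
  rw [List.mem_range'_1] at hj
  exact braidS_commute (by omega)

theorem braidS_mul_strandRep {k i : ℕ} (hik : i ≤ k) (hk : k + 1 < n - 1) :
    braidS n (k + 1) * strandRep n i = strandRep n i * braidS n k := by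
  induction hik using Nat.decreasingInduction with
  | self =>
    have hc := (braidS_commute_strandRep (n := n) (k := k) (i := k + 1 + 1) (by omega)).eq
    rw [strandRep_eq k, strandRep_eq (k + 1)]
    calc braidS n (k + 1) * (braidS n k * (braidS n (k + 1) * strandRep n (k + 1 + 1)))
        = (braidS n (k + 1) * braidS n k * braidS n (k + 1)) * strandRep n (k + 1 + 1) := by
          simp only [mul_assoc]
      _ = braidS n k * (braidS n (k + 1) * (braidS n k * strandRep n (k + 1 + 1))) := by
          rw [← braidS_braid hk]; simp only [mul_assoc]
      _ = _ := by rw [hc]; simp only [mul_assoc]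
  | of_succ i hi ih =>
    have hc := (braidS_commute (n := n) (j := i) (k := k + 1) (by omega)).eq
    rw [strandRep_eq i, ← mul_assoc, ← hc, mul_assoc, ih, mul_assoc]

/-- The pure braid in which the last strand turns once around the strand `i`. -/
def strandLoop (n i : ℕ) : BraidGroup n :=
  (strandRep n (i + 1))⁻¹ * braidS n i ^ 2 * strandRep n (i + 1)

/-- The homomorphism from the free group onto the braids in which only the last strand moves. -/
def loopHom (n : ℕ) : FreeGroup ℕ →* BraidGroup n := FreeGroup.lift (strandLoop n)

theorem loopHom_of (i : ℕ) : loopHom n (of i) = strandLoop n i := FreeGroup.lift_apply_of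

theorem conj_sq_of_braid {G : Type*} [Group G] {a b : G} (h : a * b * a = b * a * b) :
    a * b ^ 2 * a⁻¹ = b⁻¹ * a ^ 2 * b := by
  have h1 : a * b * a⁻¹ = b⁻¹ * a * b := by
    rw [mul_inv_eq_iff_eq_mul, mul_assoc b⁻¹, mul_assoc b⁻¹, eq_inv_mul_iff_mul_eq, ← mul_assoc, h]
  have h2 : a * b ^ 2 * a⁻¹ = (a * b * a⁻¹) ^ 2 := by rw [conj_pow]
  rw [h2, h1, sq, sq]
  group

theorem conj_conj_sq_of_braid {G : Type*} [Group G] {a b : G} (h : a * b * a = b * a * b) :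
    a * (b⁻¹ * a ^ 2 * b) * a⁻¹
      = (b⁻¹ * a ^ 2 * b)⁻¹ * b ^ 2 * (b⁻¹ * a ^ 2 * b) := by
  have h1 : (a * a * b * a * a) * b = b * (a * a * b * a * a) := by
    calc (a * a * b * a * a) * b = a * (a * b * a) * (a * b) := by simp only [mul_assoc]
      _ = a * (b * a * b) * (a * b) := by rw [h]
      _ = (a * b * a) * (b * a * b) := by simp only [mul_assoc]
      _ = (b * a * b) * (a * b * a) := by rw [h]
      _ = b * a * (b * a * b) * a := by simp only [mul_assoc]
      _ = b * (a * a * b * a * a) := by rw [← h]; simp only [mul_assoc]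
  have h2 : (a * a * b * a * a) * b ^ 2 = b ^ 2 * (a * a * b * a * a) := by
    rw [sq, ← mul_assoc, h1, mul_assoc b, h1, mul_assoc b b]
  calc a * (b⁻¹ * a ^ 2 * b) * a⁻¹ = a * (a * b ^ 2 * a⁻¹) * a⁻¹ := by rw [conj_sq_of_braid h]
    _ = b⁻¹ * (a ^ 2)⁻¹ * ((a * a * b * a * a) * b ^ 2) * (a ^ 2)⁻¹ := by simp only [sq]; group
    _ = _ := by rw [h2]; simp only [sq]; group

theorem braidS_mul_loopHom {k : ℕ} (hk : k + 1 < n - 1) (x : FreeGroup ℕ) :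
    braidS n k * loopHom n x = loopHom n (artin k x) * braidS n k := by
  rw [← mul_inv_eq_iff_eq_mul]
  refine FreeGroup.hom_apply_congr
    (f := (MulAut.conj (braidS n k)).toMonoidHom.comp (loopHom n))
    (g := (loopHom n).comp (artin k).toMonoidHom) (fun i => ?_) x
  simp only [MonoidHom.comp_apply, MulEquiv.coe_toMonoidHom, MulAut.conj_apply, loopHom_of]
  have hw := braidS_commute_strandRep (n := n) (k := k) (i := k + 1 + 1) (by omega)
  have conjw : ∀ x : BraidGroup n,
      braidS n k * ((strandRep n (k + 1 + 1))⁻¹ * x * strandRep n (k + 1 + 1)) * (braidS n k)⁻¹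
        = (strandRep n (k + 1 + 1))⁻¹ * (braidS n k * x * (braidS n k)⁻¹)
          * strandRep n (k + 1 + 1) := by
    intro x
    have e1 := hw.inv_right.eq
    have e2 := hw.inv_left.eq
    simp only [mul_assoc]
    rw [← e2, ← mul_assoc, e1, mul_assoc]
  have hself : strandLoop n k = (strandRep n (k + 1 + 1))⁻¹ *
      ((braidS n (k + 1))⁻¹ * braidS n k ^ 2 * braidS n (k + 1)) * strandRep n (k + 1 + 1) := by
    rw [strandLoop, strandRep_eq (k + 1)]
    group
  rcases lt_trichotomy i k with hi | rfl | hi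
  · rw [artin_of_ne (by omega) (by omega), loopHom_of, mul_inv_eq_iff_eq_mul, strandLoop]
    have e1 := braidS_mul_strandRep (n := n) (k := k) (i := i + 1) (by omega) hk
    have e2 := ((braidS_commute (n := n) (j := i) (k := k + 1) (by omega)).pow_left 2).eq
    have e3 : braidS n k * (strandRep n (i + 1))⁻¹
        = (strandRep n (i + 1))⁻¹ * braidS n (k + 1) := by
      rw [mul_inv_eq_iff_eq_mul, mul_assoc, e1, inv_mul_cancel_left]
    rw [← mul_assoc, ← mul_assoc, e3, mul_assoc _ (braidS n (k + 1)), ← e2, mul_assoc,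
      mul_assoc _ (braidS n (k + 1)), e1]
    simp only [mul_assoc]
  · rw [artin_self]
    simp only [map_mul, map_inv, loopHom_of]
    rw [hself, conjw, conj_conj_sq_of_braid (braidS_braid hk), strandLoop]
    group
  rcases eq_or_ne i (k + 1) with rfl | hi2
  · rw [artin_succ, loopHom_of, strandLoop, conjw, conj_sq_of_braid (braidS_braid hk), ← hself]
  · rw [artin_of_ne (by omega) (by omega), loopHom_of, mul_inv_eq_iff_eq_mul, strandLoop]
    have e1 := braidS_commute_strandRep (n := n) (k := k) (i := i + 1) (by omega)
    have e2 := (braidS_commute (n := n) (j := k) (k := i) (by omega)).pow_right 2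
    exact ((e1.inv_right.mul_right e2).mul_right e1).eq

theorem braidS_inv_mul_loopHom {k : ℕ} (hk : k + 1 < n - 1) (x : FreeGroup ℕ) :
    (braidS n k)⁻¹ * loopHom n x = loopHom n ((artin k).symm x) * (braidS n k)⁻¹ := by
  have := braidS_mul_loopHom hk ((artin k).symm x)
  rw [MulEquiv.apply_symm_apply] at this
  rw [inv_mul_eq_iff_eq_mul, ← mul_assoc, this, mul_inv_cancel_right]

/-- The braids on all strands but the last. -/
def lowerBraids (n : ℕ) : Subgroup (BraidGroup n) :=
  Subgroup.closure {g | ∃ k, k + 1 < n - 1 ∧ g = braidS n k}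

theorem braidS_mem_lowerBraids {k : ℕ} (hk : k + 1 < n - 1) : braidS n k ∈ lowerBraids n :=
  Subgroup.subset_closure ⟨k, hk, rfl⟩

theorem braidS_mul_strandRep_self (k : ℕ) :
    braidS n k * strandRep n k = strandRep n (k + 1) * loopHom n (of k) := by
  rw [loopHom_of, strandLoop, strandRep_eq k, mul_assoc, mul_inv_cancel_left, sq, mul_assoc]

theorem exists_eq_strandRep_mul (g : BraidGroup n) :
    ∃ j ≤ n - 1, ∃ w, ∃ b ∈ lowerBraids n, g = strandRep n j * loopHom n w * b := by
  induction g using braid_induction with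
  | one => exact ⟨n - 1, le_rfl, 1, 1, one_mem _, by simp [strandRep_of_le le_rfl]⟩
  | mul k hk g ih =>
    obtain ⟨j, hj, w, b, hb, rfl⟩ := ih
    rcases lt_trichotomy j k with h | rfl | h
    · obtain ⟨k, rfl⟩ : ∃ m, k = m + 1 := ⟨k - 1, by omega⟩
      refine ⟨j, hj, artin k w, braidS n k * b, mul_mem (braidS_mem_lowerBraids hk) hb, ?_⟩
      have e1 := braidS_mul_strandRep (n := n) (k := k) (i := j) (by omega) hk
      rw [← mul_assoc, ← mul_assoc, e1, mul_assoc _ (braidS n k), braidS_mul_loopHom hk]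
      simp only [mul_assoc]
    · refine ⟨j + 1, hk, of j * w, b, hb, ?_⟩
      rw [← mul_assoc, ← mul_assoc, braidS_mul_strandRep_self, map_mul]
      simp only [mul_assoc]
    · rcases eq_or_ne j (k + 1) with rfl | h2
      · refine ⟨k, by omega, w, b, hb, ?_⟩
        rw [strandRep_eq k]
        simp only [mul_assoc]
      · have hk' : k + 1 < n - 1 := by omega
        refine ⟨j, hj, artin k w, braidS n k * b, mul_mem (braidS_mem_lowerBraids hk') hb, ?_⟩
        have e1 := (braidS_commute_strandRep (n := n) (k := k) (i := j) (by omega)).eq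
        rw [← mul_assoc, ← mul_assoc, e1, mul_assoc _ (braidS n k), braidS_mul_loopHom hk']
        simp only [mul_assoc]
  | inv_mul k hk g ih =>
    obtain ⟨j, hj, w, b, hb, rfl⟩ := ih
    rcases lt_trichotomy j k with h | rfl | h
    · obtain ⟨k, rfl⟩ : ∃ m, k = m + 1 := ⟨k - 1, by omega⟩
      refine ⟨j, hj, (artin k).symm w, (braidS n k)⁻¹ * b,
        mul_mem (inv_mem (braidS_mem_lowerBraids hk)) hb, ?_⟩
      have e1 : (braidS n (k + 1))⁻¹ * strandRep n j = strandRep n j * (braidS n k)⁻¹ := by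
        rw [inv_mul_eq_iff_eq_mul, ← mul_assoc, braidS_mul_strandRep (by omega) hk,
          mul_inv_cancel_right]
      rw [← mul_assoc, ← mul_assoc, e1, mul_assoc _ (braidS n k)⁻¹, braidS_inv_mul_loopHom hk]
      simp only [mul_assoc]
    · refine ⟨j + 1, hk, w, b, hb, ?_⟩
      rw [strandRep_eq j]
      simp only [mul_assoc, inv_mul_cancel_left]
    · rcases eq_or_ne j (k + 1) with rfl | h2
      · refine ⟨k, by omega, (of k)⁻¹ * w, b, hb, ?_⟩
        have e1 : (braidS n k)⁻¹ * strandRep n (k + 1)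
            = strandRep n k * (loopHom n (of k))⁻¹ := by
          rw [inv_mul_eq_iff_eq_mul, ← mul_assoc, braidS_mul_strandRep_self, mul_inv_cancel_right]
        rw [← mul_assoc, ← mul_assoc, e1, map_mul, map_inv]
        simp only [mul_assoc]
      · have hk' : k + 1 < n - 1 := by omega
        refine ⟨j, hj, (artin k).symm w, (braidS n k)⁻¹ * b,
          mul_mem (inv_mem (braidS_mem_lowerBraids hk')) hb, ?_⟩
        have e1 := (braidS_commute_strandRep (n := n) (k := k) (i := j) (by omega)).inv_left.eq
        rw [← mul_assoc, ← mul_assoc, e1, mul_assoc _ (braidS n k)⁻¹, braidS_inv_mul_loopHom hk']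
        simp only [mul_assoc]

theorem strandAction_strandRep {i : ℕ} (hi : i ≤ n - 1) (f : FreeGroup ℕ) :
    strandAction n (strandRep n i) (n - 1, f) = (i, f) := by
  induction hi using Nat.decreasingInduction with
  | self => rw [strandRep_of_le le_rfl, map_one, Equiv.Perm.one_apply]
  | of_succ i hi ih =>
    rw [strandRep_eq, map_mul, Equiv.Perm.mul_apply, ih, strandAction_braidS hi, strandPerm_succ]

theorem strandAction_strandLoop {i : ℕ} (hi : i < n - 1) (f : FreeGroup ℕ) :
    strandAction n (strandLoop n i) (n - 1, f) = (n - 1, of i * f) := by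
  rw [strandLoop, map_mul, map_mul, Equiv.Perm.mul_apply, Equiv.Perm.mul_apply,
    strandAction_strandRep hi, sq, map_mul, Equiv.Perm.mul_apply, strandAction_braidS hi,
    strandPerm_succ, strandPerm_self, map_inv, Equiv.Perm.inv_eq_iff_eq, strandAction_strandRep hi]

/-- The endomorphism of the free group killing the generators with index at least `m`. -/
def truncate (m : ℕ) : FreeGroup ℕ →* FreeGroup ℕ :=
  FreeGroup.lift fun i => if i < m then of i else 1

theorem truncate_of_lt {m i : ℕ} (h : i < m) : truncate m (of i) = of i := by
  simp [truncate, h]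

theorem truncate_truncate (m : ℕ) (w : FreeGroup ℕ) :
    truncate m (truncate m w) = truncate m w := by
  refine FreeGroup.hom_apply_congr (f := (truncate m).comp (truncate m)) (g := truncate m)
    (fun i => ?_) w
  by_cases h : i < m <;> simp [truncate, h]

theorem loopHom_truncate (w : FreeGroup ℕ) : loopHom n (truncate (n - 1) w) = loopHom n w := by
  refine FreeGroup.hom_apply_congr (f := (loopHom n).comp (truncate (n - 1))) (g := loopHom n)
    (fun i => ?_) w
  by_cases h : i < n - 1
  · simp [truncate, h]
  · simp [truncate, h, loopHom_of, strandLoop, braidS_of_le (not_lt.mp h)]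

theorem strandAction_loopHom (w f : FreeGroup ℕ) :
    strandAction n (loopHom n w) (n - 1, f) = (n - 1, truncate (n - 1) w * f) := by
  induction w using FreeGroup.induction_on generalizing f with
  | C1 => simp
  | of i =>
    by_cases h : i < n - 1
    · rw [loopHom_of, strandAction_strandLoop h, truncate_of_lt h]
    · simp [truncate, h, loopHom_of, strandLoop, braidS_of_le (not_lt.mp h)]
  | inv_of i ih =>
    rw [map_inv, map_inv, Equiv.Perm.inv_eq_iff_eq, ih, map_inv, mul_inv_cancel_left]
  | mul x y hx hy => rw [map_mul, map_mul, Equiv.Perm.mul_apply, hy, hx, map_mul, mul_assoc]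

theorem braidPerm_strandRep {i : ℕ} (hi : i ≤ n - 1) : braidPerm n (strandRep n i) (n - 1) = i := by
  have := strandAction_fst (strandRep n i) (n - 1, 1)
  rw [strandAction_strandRep hi] at this
  exact this.symm

theorem braidPerm_strandRep_of_lt {i j : ℕ} (hj : j < i) :
    braidPerm n (strandRep n i) j = j := by
  rcases le_total (n - 1) i with h | h
  · rw [strandRep_of_le h, map_one, Equiv.Perm.one_apply]
  · induction h using Nat.decreasingInduction with
    | self => rw [strandRep_of_le le_rfl, map_one, Equiv.Perm.one_apply]
    | of_succ i hi ih =>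
      rw [strandRep_eq, map_mul, Equiv.Perm.mul_apply, ih (by omega), braidPerm_braidS hi,
        Equiv.swap_apply_of_ne_of_ne (by omega) (by omega)]

theorem braidPerm_loopHom (w : FreeGroup ℕ) : braidPerm n (loopHom n w) = 1 := by
  refine FreeGroup.hom_apply_congr (f := (braidPerm n).comp (loopHom n)) (g := 1) (fun i => ?_) w
  have hsq : braidPerm n (braidS n i) ^ 2 = 1 := by
    by_cases h : i < n - 1
    · rw [braidPerm_braidS h, sq, Equiv.swap_mul_self]
    · rw [braidS_of_le (not_lt.mp h), map_one, one_pow]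
  simp [loopHom_of, strandLoop, hsq]

theorem braidPerm_lowerBraids {b : BraidGroup n} (hb : b ∈ lowerBraids n) :
    braidPerm n b (n - 1) = n - 1 := by
  have : lowerBraids n ≤ (MulAction.stabilizer (Equiv.Perm ℕ) (n - 1)).comap (braidPerm n) := by
    rw [lowerBraids, Subgroup.closure_le]
    rintro _ ⟨k, hk, rfl⟩
    change braidPerm n (braidS n k) (n - 1) = n - 1
    rw [braidPerm_braidS (by omega), Equiv.swap_apply_of_ne_of_ne (by omega) (by omega)]
  exact this hb

theorem exists_eq_loopHom_mul {g : BraidGroup n} (hg : braidPerm n g (n - 1) = n - 1) :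
    ∃ w, ∃ b ∈ lowerBraids n, g = loopHom n w * b := by
  obtain ⟨j, hj, w, b, hb, rfl⟩ := exists_eq_strandRep_mul g
  rw [map_mul, map_mul, braidPerm_loopHom, mul_one, Equiv.Perm.mul_apply,
    braidPerm_lowerBraids hb, braidPerm_strandRep hj] at hg
  subst hg
  exact ⟨w, b, hb, by rw [strandRep_of_le le_rfl, one_mul]⟩

theorem exists_artin_of_eq_conj (k m : ℕ) :
    ∃ g, artin k (of m) = g * of (Equiv.swap k (k + 1) m) * g⁻¹ := by
  rcases eq_or_ne m k with rfl | h1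
  · exact ⟨(of m)⁻¹, by rw [artin_self, Equiv.swap_apply_left, inv_inv]⟩
  rcases eq_or_ne m (k + 1) with rfl | h2
  · exact ⟨1, by rw [artin_succ, Equiv.swap_apply_right]; simp⟩
  · exact ⟨1, by rw [artin_of_ne h1 h2, Equiv.swap_apply_of_ne_of_ne h1 h2]; simp⟩

theorem exists_artin_symm_of_eq_conj (k m : ℕ) :
    ∃ g, (artin k).symm (of m) = g * of (Equiv.swap k (k + 1) m) * g⁻¹ := by
  obtain ⟨g, hg⟩ := exists_artin_of_eq_conj k (Equiv.swap k (k + 1) m)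
  rw [Equiv.swap_apply_self] at hg
  refine ⟨((artin k).symm g)⁻¹, ?_⟩
  have := congrArg (artin k).symm hg
  rw [MulEquiv.symm_apply_apply, map_mul, map_mul, map_inv] at this
  rw [this]
  group

theorem exists_conj_strandLoop {b : BraidGroup n} (hb : b ∈ lowerBraids n) (i : ℕ) :
    ∃ h, b * strandLoop n i * b⁻¹ = loopHom n (h * of (braidPerm n b i) * h⁻¹) := by
  induction hb using Subgroup.closure_induction_left with
  | one => exact ⟨1, by simp [loopHom_of]⟩
  | mul_left x hx y hy ih =>
    obtain ⟨k, hk, rfl⟩ := hx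
    obtain ⟨h, hh⟩ := ih
    obtain ⟨g, hg⟩ := exists_artin_of_eq_conj k (braidPerm n y i)
    refine ⟨artin k h * g, ?_⟩
    calc braidS n k * y * strandLoop n i * (braidS n k * y)⁻¹
        = braidS n k * (y * strandLoop n i * y⁻¹) * (braidS n k)⁻¹ := by group
      _ = _ := by
        rw [hh, braidS_mul_loopHom hk, mul_inv_cancel_right, map_mul (artin k),
          map_mul (artin k), hg, map_mul (braidPerm n), Equiv.Perm.mul_apply,
          braidPerm_braidS (by omega), map_inv]
        congr 1
        group
  | inv_mul_cancel x hx y hy ih =>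
    obtain ⟨k, hk, rfl⟩ := hx
    obtain ⟨h, hh⟩ := ih
    obtain ⟨g, hg⟩ := exists_artin_symm_of_eq_conj k (braidPerm n y i)
    refine ⟨(artin k).symm h * g, ?_⟩
    calc (braidS n k)⁻¹ * y * strandLoop n i * ((braidS n k)⁻¹ * y)⁻¹
        = (braidS n k)⁻¹ * (y * strandLoop n i * y⁻¹) * (braidS n k)⁻¹⁻¹ := by group
      _ = _ := by
        rw [hh, braidS_inv_mul_loopHom hk, mul_inv_cancel_right, map_mul (artin k).symm,
          map_mul (artin k).symm, hg, map_mul (braidPerm n), Equiv.Perm.mul_apply,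
          map_inv (braidPerm n), braidPerm_braidS (by omega), Equiv.swap_inv, map_inv]
        congr 1
        group

theorem exists_conj_strandLoop_of_perm {d : BraidGroup n}
    (hd : braidPerm n d (n - 1) = n - 1) (i : ℕ) :
    ∃ f, truncate (n - 1) f = f ∧
      d * strandLoop n i * d⁻¹ = loopHom n (f * of (braidPerm n d i) * f⁻¹) := by
  obtain ⟨w, b, hb, rfl⟩ := exists_eq_loopHom_mul hd
  obtain ⟨h, hh⟩ := exists_conj_strandLoop hb i
  refine ⟨truncate (n - 1) (w * h), truncate_truncate _ _, ?_⟩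
  rw [map_mul (braidPerm n), braidPerm_loopHom, one_mul]
  calc loopHom n w * b * strandLoop n i * (loopHom n w * b)⁻¹
      = loopHom n w * (b * strandLoop n i * b⁻¹) * (loopHom n w)⁻¹ := by group
    _ = _ := by
      rw [hh]
      simp only [map_mul (loopHom n), map_inv (loopHom n), loopHom_truncate]
      group

/-- The braids that fix the last strand. -/
def lastStrandStabilizer (n : ℕ) : Subgroup (BraidGroup n) :=
  (MulAction.stabilizer (Equiv.Perm ℕ) (n - 1)).comap (braidPerm n)

theorem mem_lastStrandStabilizer {g : BraidGroup n} :
    g ∈ lastStrandStabilizer n ↔ braidPerm n g (n - 1) = n - 1 := Iff.rfl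

theorem loopHom_mem_lastStrandStabilizer (w : FreeGroup ℕ) :
    loopHom n w ∈ lastStrandStabilizer n := by
  rw [mem_lastStrandStabilizer, braidPerm_loopHom, Equiv.Perm.one_apply]

/-- The element of the free group to which a braid fixing the last strand moves the identity. -/
def strandOrbit (g : BraidGroup n) : FreeGroup ℕ := (strandAction n g (n - 1, 1)).2

theorem strandAction_eq_of_mem {g : BraidGroup n} (hg : g ∈ lastStrandStabilizer n) :
    strandAction n g (n - 1, 1) = (n - 1, strandOrbit g) :=
  Prod.ext ((strandAction_fst g _).trans hg) rfl

theorem strandOrbit_loopHom_mul (w : FreeGroup ℕ) {g : BraidGroup n}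
    (hg : g ∈ lastStrandStabilizer n) :
    strandOrbit (loopHom n w * g) = truncate (n - 1) w * strandOrbit g := by
  rw [strandOrbit, map_mul, Equiv.Perm.mul_apply, strandAction_eq_of_mem hg, strandAction_loopHom]

/-- Two twists sharing the last strand. -/
theorem splitPair_strandLoop {i j : ℕ} (hi : i < n - 1) (hj : j < n - 1) {f : FreeGroup ℕ}
    (hf : truncate (n - 1) f = f) :
    SplitPair (strandLoop n i) (loopHom n (f * of j * f⁻¹)) := by
  obtain ⟨a, b, f₀, hf₀, h1, h2⟩ := FreeGroup.exists_trimmed i j f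
  have ht : truncate (n - 1) f₀ = f₀ := by
    have : f₀ = of i ^ (-a) * f * of j ^ (-b) := by rw [hf₀]; group
    rw [this, map_mul, map_mul, map_zpow, map_zpow, truncate_of_lt hi, truncate_of_lt hj, hf]
  have key : SplitPair (strandLoop n i) (loopHom n (f₀ * of j * f₀⁻¹)) := by
    by_cases hne : f₀ ≠ 1 ∨ i ≠ j
    · refine Or.inr (Or.inl fun P Q hPQ => ?_)
      rw [← loopHom_of] at hPQ ⊢
      refine subOne_mul_eq_zero_of_growth (lastStrandStabilizer n)
        (loopHom_mem_lastStrandStabilizer _) (loopHom_mem_lastStrandStabilizer _)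
        (fun g => (strandOrbit g).norm) (fun g hg => ?_) hPQ
      simp only [← map_zpow, strandOrbit_loopHom_mul _ hg]
      simp only [map_zpow, map_mul, map_inv, truncate_of_lt hi, truncate_of_lt hj, ht]
      exact FreeGroup.norm_lt_of_trimmed h1 h2 hne _
    · push Not at hne
      left
      rw [hne.1, hne.2, one_mul, inv_one, mul_one, loopHom_of]
  have := key.conj (loopHom n (of i ^ a))
  convert this using 1
  · rw [map_zpow, loopHom_of]
    group
  · rw [← map_inv, ← map_mul, ← map_mul, hf₀]
    congr 1
    group

/-- The change of basis sending `of 1 * of 0` to the generator `of 1`. -/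
def twistBasis : FreeGroup ℕ →* FreeGroup ℕ :=
  FreeGroup.lift fun i => if i = 1 then of 1 * (of 0)⁻¹ else of i

theorem twistBasis_one : twistBasis (of 1) = of 1 * (of 0)⁻¹ := by simp [twistBasis]

theorem twistBasis_of_ne {i : ℕ} (h : i ≠ 1) : twistBasis (of i) = of i := by simp [twistBasis, h]

theorem twistBasis_injective : Function.Injective twistBasis := by
  refine Function.LeftInverse.injective
    (g := FreeGroup.lift fun i => if i = 1 then of 1 * of 0 else of i) fun x => ?_
  refine FreeGroup.hom_apply_congr
    (f := (FreeGroup.lift fun i => if i = 1 then of 1 * of 0 else of i).comp twistBasis)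
    (g := MonoidHom.id _) (fun i => ?_) x
  by_cases h : i = 1
  · subst h; simp [twistBasis]
  · simp [twistBasis, h]

theorem twistBasis_artin_artin (x : FreeGroup ℕ) :
    twistBasis (artin 0 (artin 0 x)) = FreeGroup.twist 0 1 1 (twistBasis x) := by
  refine FreeGroup.hom_apply_congr
    (f := twistBasis.comp ((artin 0).toMonoidHom.comp (artin 0).toMonoidHom))
    (g := (FreeGroup.twist 0 1 1).comp twistBasis) (fun i => ?_) x
  simp only [MonoidHom.comp_apply, MulEquiv.coe_toMonoidHom]
  have a0 : artin 0 (of 0) = (of 0)⁻¹ * of 1 * of 0 := artin_self 0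
  have a1 : artin 0 (of 1) = of 0 := artin_succ 0
  have b0 : twistBasis (of 0) = of 0 := twistBasis_of_ne (by omega)
  have t1 : FreeGroup.twist 0 1 1 (of 1) = of 1 := FreeGroup.twist_of_ne (by omega) _
  rcases eq_or_ne i 0 with rfl | h0
  · simp only [a0, a1, map_mul, map_inv, b0, twistBasis_one, FreeGroup.twist_self]
    group
  rcases eq_or_ne i 1 with rfl | h1
  · simp only [a0, a1, map_mul, map_inv, b0, twistBasis_one, FreeGroup.twist_self, t1]
    group
  · rw [artin_of_ne h0 h1, artin_of_ne h0 h1, twistBasis_of_ne h1, FreeGroup.twist_of_ne h0]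

theorem strandAction_braidS_zero_sq (h : 1 < n - 1) (x : FreeGroup ℕ) :
    strandAction n (braidS n 0 ^ 2) (n - 1, x) = (n - 1, artin 0 (artin 0 x)) := by
  rw [sq, map_mul, Equiv.Perm.mul_apply, strandAction_braidS (by omega), strandPerm_gt (i := n - 1) (by omega),
    strandPerm_gt (by omega)]

theorem strandAction_braidS_zero_zpow (h : 1 < n - 1) (k : ℤ) (x : FreeGroup ℕ) :
    ∃ y, strandAction n ((braidS n 0 ^ 2) ^ k) (n - 1, x) = (n - 1, y) ∧
      twistBasis y = FreeGroup.twist 0 1 k (twistBasis x) := by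
  induction k using Int.induction_on with
  | zero => exact ⟨x, by simp, by rw [FreeGroup.twist_zero]⟩
  | succ k ih =>
    obtain ⟨y, hy, hty⟩ := ih
    refine ⟨artin 0 (artin 0 y), ?_, ?_⟩
    · rw [add_comm, zpow_one_add, map_mul, Equiv.Perm.mul_apply, hy, strandAction_braidS_zero_sq h]
    · rw [twistBasis_artin_artin, hty, FreeGroup.twist_twist (by omega), add_comm]
  | pred k ih =>
    obtain ⟨y, hy, hty⟩ := ih
    have hs : artin 0 (artin 0 ((artin 0).symm ((artin 0).symm y))) = y := by simp
    refine ⟨(artin 0).symm ((artin 0).symm y), ?_, ?_⟩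
    · rw [sub_eq_neg_add, zpow_add, zpow_neg_one, map_mul, Equiv.Perm.mul_apply, hy, map_inv,
        Equiv.Perm.inv_eq_iff_eq, strandAction_braidS_zero_sq h, hs]
    · have := twistBasis_artin_artin ((artin 0).symm ((artin 0).symm y))
      rw [hs, hty] at this
      have h2 := congrArg (FreeGroup.twist 0 1 (-1)) this
      rw [FreeGroup.twist_twist (by omega), FreeGroup.twist_twist (by omega), neg_add_cancel,
        FreeGroup.twist_zero] at h2
      rw [← h2, sub_eq_neg_add]

theorem zpow_eq_one_of_degree {u : BraidGroup n} (hu : braidDegree n u = Multiplicative.ofAdd 2)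
    {k : ℤ} (hk : u ^ k = 1) : k = 0 := by
  have := congrArg (braidDegree n) hk
  rw [map_zpow, hu, map_one, ← ofAdd_zsmul, ofAdd_eq_one] at this
  simpa using this

theorem braidDegree_conj_sq (d : BraidGroup n) {i : ℕ} (hi : i < n - 1) :
    braidDegree n (d * braidS n i ^ 2 * d⁻¹) = Multiplicative.ofAdd 2 := by
  rw [map_mul, map_mul, map_inv, mul_comm, inv_mul_cancel_left, map_pow, braidDegree_braidS hi]
  rfl

/-- Two twists without common strand. -/
theorem splitPair_braidS_zero_sq (h : 1 < n - 1) {j : ℕ} (hj : j < n - 1) (hj0 : j ≠ 0)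
    (hj1 : j ≠ 1) {f : FreeGroup ℕ} (hf : truncate (n - 1) f = f) :
    SplitPair (braidS n 0 ^ 2) (loopHom n (f * of j * f⁻¹)) := by
  have htr : truncate (n - 1) (f * of j * f⁻¹) = f * of j * f⁻¹ := by
    rw [map_mul, map_mul, map_inv, hf, truncate_of_lt hj]
  have hbasis : twistBasis (f * of j * f⁻¹) = twistBasis f * of j * (twistBasis f)⁻¹ := by
    rw [map_mul, map_mul, map_inv, twistBasis_of_ne hj1]
  right
  rcases Nat.eq_zero_or_pos (FreeGroup.genCount 0 (twistBasis f)) with hz | hz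
  · right
    refine ⟨?_, fun a b hab => ?_⟩
    · have hfix : artin 0 (artin 0 (f * of j * f⁻¹)) = f * of j * f⁻¹ := by
        apply twistBasis_injective
        rw [twistBasis_artin_artin, hbasis, map_mul, map_mul, map_inv, FreeGroup.twist_eq_self hz,
          FreeGroup.twist_of_ne hj0]
      change _ * _ = _ * _
      rw [sq, mul_assoc, braidS_mul_loopHom (by omega), ← mul_assoc, braidS_mul_loopHom (by omega),
        hfix, mul_assoc]
    · have hb : b = 0 := by
        obtain ⟨y, hy, hty⟩ := strandAction_braidS_zero_zpow h a 1
        rw [map_one, map_one] at hty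
        rw [hab, ← map_zpow, strandAction_loopHom, map_zpow, htr, mul_one, conj_zpow] at hy
        have hy2 := (Prod.ext_iff.mp hy).2
        rw [twistBasis_injective (hty.trans (map_one _).symm)] at hy2
        simp only [mul_inv_eq_one, mul_eq_left] at hy2
        exact FreeGroup.of_zpow_eq_one hy2
      rw [hb, zpow_zero] at hab
      refine zpow_eq_one_of_degree (u := braidS n 0 ^ 2) ?_ hab
      have := braidDegree_conj_sq 1 (show 0 < n - 1 by omega)
      rwa [one_mul, inv_one, mul_one] at this
  · left
    intro P Q hPQ
    have hmem : braidS n 0 ^ 2 ∈ lastStrandStabilizer n := by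
      rw [mem_lastStrandStabilizer, map_pow, braidPerm_braidS (by omega), sq, Equiv.swap_mul_self,
        Equiv.Perm.one_apply]
    refine subOne_mul_eq_zero_of_growth (lastStrandStabilizer n) hmem
      (loopHom_mem_lastStrandStabilizer _)
      (fun g => FreeGroup.genCount 0 (twistBasis (strandOrbit g)) +
        FreeGroup.genCount 0 ((twistBasis f)⁻¹ * twistBasis (strandOrbit g)))
      (fun g hg => ?_) hPQ
    have hu : ∀ k : ℤ, twistBasis (strandOrbit ((braidS n 0 ^ 2) ^ k * g))
        = FreeGroup.twist 0 1 k (twistBasis (strandOrbit g)) := by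
      intro k
      obtain ⟨y, hy, hty⟩ := strandAction_braidS_zero_zpow h k (strandOrbit g)
      rw [← hty, strandOrbit, map_mul, Equiv.Perm.mul_apply, strandAction_eq_of_mem hg, hy]
    simp only [hu]
    simp only [← map_zpow, strandOrbit_loopHom_mul _ hg]
    simp only [map_zpow, htr, map_mul twistBasis _ (strandOrbit g), hbasis]
    exact FreeGroup.genCount_lt_of_pos (by omega) hj0 hz _

theorem exists_braidS_eq_conj {i : ℕ} (hi : i < n - 1) :
    ∃ d, braidS n i = d * braidS n 0 * d⁻¹ := by
  induction i with
  | zero => exact ⟨1, by simp⟩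
  | succ i ih =>
    obtain ⟨d, hd⟩ := ih (by omega)
    refine ⟨braidS n i * braidS n (i + 1) * d, ?_⟩
    have := braidS_braid hi
    calc braidS n (i + 1)
        = (braidS n (i + 1) * braidS n i * braidS n (i + 1)) *
          (braidS n i * braidS n (i + 1))⁻¹ := by group
      _ = (braidS n i * braidS n (i + 1)) * braidS n i * (braidS n i * braidS n (i + 1))⁻¹ := by
        rw [← this]
      _ = _ := by
        rw [mul_inv_rev _ d, ← mul_assoc, mul_assoc _ d, mul_assoc _ (d * braidS n 0), ← hd]

theorem splitPair_braidS_zero_sq_conj (hn : 0 < n - 1) (d : BraidGroup n) :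
    SplitPair (braidS n 0 ^ 2) (d * braidS n (n - 1 - 1) ^ 2 * d⁻¹) := by
  have hlast : strandLoop n (n - 1 - 1) = braidS n (n - 1 - 1) ^ 2 := by
    rw [strandLoop, strandRep_of_le (by omega), inv_one, one_mul, mul_one]
  have shared : ∀ d : BraidGroup n, braidPerm n d (n - 1) ≤ 1 →
      SplitPair (braidS n 0 ^ 2) (d * braidS n (n - 1 - 1) ^ 2 * d⁻¹) := by
    intro d hd
    set q := braidPerm n d (n - 1) with hq
    have hfix : braidPerm n ((strandRep n q)⁻¹ * d) (n - 1) = n - 1 := by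
      rw [map_mul, Equiv.Perm.mul_apply, ← hq, map_inv, Equiv.Perm.inv_eq_iff_eq,
        braidPerm_strandRep (by omega)]
    obtain ⟨f, hf, hfd⟩ := exists_conj_strandLoop_of_perm hfix (n - 1 - 1)
    have hlt : braidPerm n ((strandRep n q)⁻¹ * d) (n - 1 - 1) < n - 1 := by
      refine lt_of_le_of_ne (braidPerm_le _ (by omega)) fun hcon => ?_
      have := (braidPerm n ((strandRep n q)⁻¹ * d)).injective (hcon.trans hfix.symm)
      omega
    have key := splitPair_strandLoop hn hlt hf
    rw [← hfd, hlast] at key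
    refine SplitPair.of_conj (strandRep n q)⁻¹ ?_
    convert key using 1
    · rcases Nat.le_one_iff_eq_zero_or_eq_one.mp hd with h0 | h1
      · rw [h0, strandLoop, strandRep_eq 0]
        group
      · rw [h1, strandLoop, inv_inv]
    · group
  by_cases h1 : braidPerm n d (n - 1) ≤ 1
  · exact shared d h1
  by_cases h2 : braidPerm n d (n - 1 - 1) ≤ 1
  · have := shared (d * braidS n (n - 1 - 1)) (by
      have e : n - 1 - 1 + 1 = n - 1 := by omega
      have e2 := Equiv.swap_apply_right (n - 1 - 1) (n - 1 - 1 + 1)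
      rw [map_mul, Equiv.Perm.mul_apply, braidPerm_braidS (by omega)]
      rw [e] at e2 ⊢
      rwa [e2])
    convert this using 1
    group
  set q := braidPerm n d (n - 1) with hq
  have hqn : q ≤ n - 1 := braidPerm_le _ le_rfl
  have hfix : braidPerm n ((strandRep n q)⁻¹ * d) (n - 1) = n - 1 := by
    rw [map_mul, Equiv.Perm.mul_apply, ← hq, map_inv, Equiv.Perm.inv_eq_iff_eq,
      braidPerm_strandRep hqn]
  obtain ⟨f, hf, hfd⟩ := exists_conj_strandLoop_of_perm hfix (n - 1 - 1)
  set j := braidPerm n ((strandRep n q)⁻¹ * d) (n - 1 - 1) with hj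
  have hlt : j < n - 1 := by
    refine lt_of_le_of_ne (braidPerm_le _ (by omega)) fun hcon => ?_
    have := (braidPerm n ((strandRep n q)⁻¹ * d)).injective ((hj.symm.trans hcon).trans hfix.symm)
    omega
  have hjd : braidPerm n (strandRep n q) j = braidPerm n d (n - 1 - 1) := by
    rw [hj, ← Equiv.Perm.mul_apply, ← map_mul, mul_inv_cancel_left]
  have hj2 : ¬ j ≤ 1 := by
    intro hcon
    rw [braidPerm_strandRep_of_lt (by omega)] at hjd
    omega
  have key := splitPair_braidS_zero_sq (n := n) (by omega) hlt (by omega) (by omega) hf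
  rw [← hfd, hlast] at key
  refine SplitPair.of_conj (strandRep n q)⁻¹ ?_
  convert key using 1
  · have hc : Commute (braidS n 0) (strandRep n q) := braidS_commute_strandRep (by omega)
    rw [inv_inv, mul_assoc, (hc.pow_left 2).eq, inv_mul_cancel_left]
  · group

theorem exists_eq_conj_braidS_sq {u : BraidGroup n} (hu : u ∈ conjSquares n) {i : ℕ}
    (hi : i < n - 1) : ∃ d, u = d * braidS n i ^ 2 * d⁻¹ := by
  obtain ⟨a, j, rfl⟩ := hu
  obtain ⟨c, hc⟩ := exists_braidS_eq_conj (n := n) j.2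
  obtain ⟨d, hd⟩ := exists_braidS_eq_conj hi
  refine ⟨a * c * d⁻¹, ?_⟩
  rw [← braidS_of_lt j.2, hc, hd, conj_pow, conj_pow]
  group

theorem zero_lt_of_mem_conjSquares {u : BraidGroup n} (hu : u ∈ conjSquares n) : 0 < n - 1 := by
  obtain ⟨_, i, _⟩ := hu
  exact i.pos

end StrandSubgroup

theorem theorem1p3 (n : ℕ) : Function.Injective (nuHom n) := by
  refine nuHom_injective_of_splitPair (fun u hu k hk => ?_) fun u hu v hv => ?_
  · have hn := zero_lt_of_mem_conjSquares hu
    obtain ⟨d, rfl⟩ := exists_eq_conj_braidS_sq hu hn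
    exact zpow_eq_one_of_degree (braidDegree_conj_sq d hn) hk
  · have hn := zero_lt_of_mem_conjSquares hu
    obtain ⟨a, rfl⟩ := exists_eq_conj_braidS_sq hu hn
    obtain ⟨b, rfl⟩ := exists_eq_conj_braidS_sq hv (show n - 1 - 1 < n - 1 by omega)
    refine SplitPair.of_conj a⁻¹ ?_
    convert splitPair_braidS_zero_sq_conj hn (a⁻¹ * b) using 1 <;> group
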